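/- Let $Q_1=\chi_{[0,1)}$ and $Q_{m+1}(t)=\int_{-\infty}^{\infty}Q_m(t-y)Q_1(y)\,dy$ be the cardinal B-splines, and let $$V(Q_m)=\Big\{f\in L^2(\mathbb R): f(x)=\sum_{k\in\mathbb Z}c_kQ_m(x-k)\ \text{for some}\ (c_k)\in\ell^2(\mathbb Z)\Big\}$$ (complex coefficients; the elements are the functions given pointwise by these locally finite sums). Let $\rho\ge 1$ and $m>\rho$ be integers, let $a\in\{0,\tfrac12\}$, put $\kappa=(Q_m,a,\rho)$, and let $\Psi_\kappa(t)$ be the $\rho\times\rho$ matrix with entries $$\Psi^{ij}_\kappa(t)=\sum_{k\in\mathbb Z}Q_m^{(i)}(a+\rho k-j)\,e^{2\pi \mathrm i kt},\qquad 0\le i,j\le\rho-1 .$$ Assume that $\det\Psi_\kappa(t)\ne0$ for all $t\in[0,1]$. (Assumption 1, a conjecture, says that for $m>\rho$ and $a\in\{0,\frac12\}$ this is the case if and only if either $m$ is even and $a=\langle\frac{\rho+1}2\rangle$, or $m$ is odd and $a=\langle\frac\rho2\rangle$, where $\langle x\rangle$ is the fractional part of $x$. So if Assumption 1 holds, the theorem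 applies to exactly these $m,a,\rho$.) Then $a+\rho\mathbb Z$ is a complete interpolation set of order $\rho-1$ for $V(Q_m)$, that is: (i) if $f\in V(Q_m)$ and $f^{(i)}(a+\rho l)=0$ for all $l\in\mathbb Z$ and $0\le i\le\rho-1$, then $f=0$; and (ii) for every square summable family $(c_{l,i})_{l\in\mathbb Z,\,0\le i\le\rho-1}$ of complex numbers there is $f\in V(Q_m)$ with $f^{(i)}(a+\rho l)=c_{l,i}$ for all $l$ and $i$. Moreover, every $f\in V(Q_m)$ is of class $C^{\rho-1}$ and satisfies $$A_\kappa\|f\|_2^2\le\sum_{i=0}^{\rho-1}\sum_{l\in\mathbb Z}|f^{(i)}(a+\rho l)|^2\le B_\kappa\,\frac{\pi^{2m-1}}{2^{2m-1}K_{2m-1}}\,\|f\|_2^2,$$ where the middle sum converges, $$A_\kappa=\inf_{t\in[0,1]}\lambda_{\min}\big(\Psi_\kappa^*\Psi_\kappa(t)\big)>0,\qquad B_\kappa=\sup_{t\in[0,1]}\lambda_{\max}\big(\Psi_\kappa^*\Psi_\kappa(t)\big),$$ $\lambda_{\min}$ and $\lambda_{\max}$ denote the smallest and the largest eigenvalue,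 and $K_n=\frac4\pi\sum_{\nu=0}^{\infty}\frac{(-1)^{\nu(n+1)}}{(2\nu+1)^{n+1}}$ is the Krein-Favard constant. -/

import Mathlib

open scoped Matrix

namespace SplineSampling

noncomputable section

/-- The cardinal B-splines `Q_m`, `m ≥ 1`: `Q_1` is the indicator function of `[0,1)` and
`Q_{m+1}` is the convolution of `Q_m` with `Q_1`. The value at index `0` is a dummy. -/
def bspline : ℕ → ℝ → ℝ
  | 0 => fun _ => 0
  | 1 => Set.indicator (Set.Ico 0 1) (fun _ => 1)
  | (m + 2) => fun t =>
      ∫ y : ℝ, bspline (m + 1) (t - y) * Set.indicator (Set.Ico (0 : ℝ) 1) (fun _ => (1 : ℝ)) y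

/-- The shift-invariant space `V(φ)`: all square integrable `f : ℝ → ℂ` of the form
`f(x) = ∑_{k ∈ ℤ} c_k φ(x - k)` with `(c_k) ∈ ℓ²(ℤ)`. Its members are functions rather than
almost-everywhere classes, so that point samples make sense. -/
def shiftInvariantSpace (φ : ℝ → ℝ) : Set (ℝ → ℂ) :=
  {f | MeasureTheory.MemLp f 2 MeasureTheory.volume ∧
    ∃ c : ℤ → ℂ, Summable (fun k => ‖c k‖ ^ 2) ∧
      ∀ x : ℝ, HasSum (fun k : ℤ => c k * (φ (x - (k : ℝ)) : ℂ)) (f x)}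

/-- `Γ = {x_n : n ∈ ℤ}` is a set of uniqueness of order `r` for `V(φ)`. -/
def IsUniquenessSet (φ : ℝ → ℝ) (r : ℕ) (x : ℤ → ℝ) : Prop :=
  ∀ f ∈ shiftInvariantSpace φ,
    (∀ (n : ℤ) (i : Fin (r + 1)), iteratedDeriv (i : ℕ) f (x n) = 0) → f = 0

/-- `Γ = {x_n : n ∈ ℤ}` is a set of interpolation of order `r` for `V(φ)`. -/
def IsInterpolationSet (φ : ℝ → ℝ) (r : ℕ) (x : ℤ → ℝ) : Prop :=
  ∀ c : ℤ → Fin (r + 1) → ℂ,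
    Summable (fun p : ℤ × Fin (r + 1) => ‖c p.1 p.2‖ ^ 2) →
      ∃ f ∈ shiftInvariantSpace φ,
        ∀ (n : ℤ) (i : Fin (r + 1)), iteratedDeriv (i : ℕ) f (x n) = c n i

/-- A complete interpolation set of order `r` for `V(φ)`. -/
def IsCompleteInterpolationSet (φ : ℝ → ℝ) (r : ℕ) (x : ℤ → ℝ) : Prop :=
  IsUniquenessSet φ r x ∧ IsInterpolationSet φ r x

/-- The `ρ × ρ` matrix symbol `Ψ_κ(t)`, `κ = (φ, a, ρ)`, with entries
`∑_{k ∈ ℤ} φ^{(i)}(a + ρ k - j) e^{2π i k t}`. -/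
def symbol (φ : ℝ → ℝ) (a : ℝ) (ρ : ℕ) (t : ℝ) : Matrix (Fin ρ) (Fin ρ) ℂ :=
  Matrix.of fun i j =>
    ∑' k : ℤ, ((iteratedDeriv (i : ℕ) φ (a + (ρ : ℝ) * (k : ℝ) - ((j : ℕ) : ℝ)) : ℝ) : ℂ) *
      Complex.exp (2 * (Real.pi : ℂ) * Complex.I * (k : ℂ) * (t : ℂ))

/-- The smallest eigenvalue of `A* A`. -/
def minEigenvalueGram {n : ℕ} (A : Matrix (Fin n) (Fin n) ℂ) : ℝ :=
  ⨅ i : Fin n, (Matrix.isHermitian_conjTranspose_mul_self A).eigenvalues i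

/-- The largest eigenvalue of `A* A`. -/
def maxEigenvalueGram {n : ℕ} (A : Matrix (Fin n) (Fin n) ℂ) : ℝ :=
  ⨆ i : Fin n, (Matrix.isHermitian_conjTranspose_mul_self A).eigenvalues i

/-- `A_κ`: the infimum over `t ∈ [0,1]` of the smallest eigenvalue of `Ψ_κ(t)* Ψ_κ(t)`. -/
def lowerConst (φ : ℝ → ℝ) (a : ℝ) (ρ : ℕ) : ℝ :=
  ⨅ t : Set.Icc (0 : ℝ) 1, minEigenvalueGram (symbol φ a ρ t)

/-- `B_κ`: the supremum over `t ∈ [0,1]` of the largest eigenvalue of `Ψ_κ(t)* Ψ_κ(t)`. -/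
def upperConst (φ : ℝ → ℝ) (a : ℝ) (ρ : ℕ) : ℝ :=
  ⨆ t : Set.Icc (0 : ℝ) 1, maxEigenvalueGram (symbol φ a ρ t)

/-- The Krein-Favard constant `K_n` (the series converges absolutely for `n ≥ 1`). -/
def favardConst (n : ℕ) : ℝ :=
  4 / Real.pi * ∑' ν : ℕ, (-1 : ℝ) ^ (ν * (n + 1)) / (2 * (ν : ℝ) + 1) ^ (n + 1)

end

end SplineSampling

/-! Write `f = ∑ c_k Q_m(· - k)` and split `c` by residues mod `ρ` into the sequences `c_j(n) =
c_{ρn+j}`. Since `a + ρl - (ρ(l-k)+j) = a + ρk - j`, the samples `f^{(i)}(a + ρl)` are a finite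
convolution system in the `c_j` with coefficients `Q_m^{(i)}(a + ρk - j)`
(`iteratedDeriv_spline_eq_trigConv`). On the Fourier side this is multiplication by the matrix
symbol on `ℂ^ρ`-valued `L²` functions on the circle. The symbol is continuous and everywhere
invertible, so its inverse is continuous too. Hence every square summable datum is attained
(`exists_trigConv_eq`), and integrating the eigenvalue bounds of `Ψ*Ψ` compares the sample energy
with `∑ |c_k|²` (`trigConv_bounds`).

It remains to compare `∑ |c_k|²` with `‖f‖²` (`spline_norm_bounds`). If `F` has Fourier coefficients
`c_k` and `Z` is the Zak transform of `Q_m`, Parseval gives `‖f‖² = ∫ |F(t)|² G(t) dt` with `G(t) =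
∫₀¹ |Z(x,t)|² dx`. A second use of Parseval turns `G(t)` into `∑ |Q̂_m(n - t)|² = (sin πt / π)^{2m}
∑ (t + k)^{-2m}`, a polynomial in `cos πt`. That polynomial is even with nonnegative coefficients,
so its minimum on `[-1,1]` is at `0` and its maximum is the value `1` at `1`. The value at `0` is a
series over odd integers, and its reciprocal is the Krein-Favard factor (`favard_factor`). -/

namespace SplineSampling

/-! ### Cosine polynomials for the lattice sums of inverse powers -/

open Polynomial in
/-- The polynomials `p` with `∑ₖ (x + k)⁻ⁿ⁻² = (π / sin πx)ⁿ⁺² p n (cos πx)`. -/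
noncomputable def cscPoly : ℕ → ℝ[X]
  | 0 => 1
  | n + 1 => X * cscPoly n + C ((n + 2 : ℝ)⁻¹) * ((1 - X ^ 2) * derivative (cscPoly n))

-- Positivity and the degree bound go through one induction: the new coefficient at `X^(k+2)`
-- contains the old one at `X^(k+1)` times `(n + 2 - (k+1)) / (n+2)`, which is nonnegative as long
-- as `k + 1 ≤ n`.
open Polynomial in
theorem cscPoly_coeff_nonneg (n : ℕ) :
    (∀ k, 0 ≤ (cscPoly n).coeff k) ∧ ∀ k, n < k → (cscPoly n).coeff k = 0 := by
  induction n with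
  | zero =>
    refine ⟨fun k => ?_, fun k hk => ?_⟩
    · simp only [cscPoly, coeff_one]; split_ifs <;> norm_num
    · simp [cscPoly, coeff_one, hk.ne']
  | succ n ih =>
    obtain ⟨h0, h1⟩ := ih
    have e : ∀ k, (cscPoly (n + 1)).coeff k = (X * cscPoly n).coeff k
        + (n + 2 : ℝ)⁻¹ * ((derivative (cscPoly n)).coeff k
          - (X ^ 2 * derivative (cscPoly n)).coeff k) := by
      intro k
      rw [cscPoly, coeff_add, coeff_C_mul, sub_mul, one_mul, coeff_sub]
    have hn : (0 : ℝ) < n + 2 := by positivity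
    refine ⟨fun k => ?_, fun k hk => ?_⟩
    · rw [e]
      rcases k with _ | _ | k
      · simp only [coeff_X_mul_zero, coeff_derivative, coeff_X_pow_mul']
        simpa using mul_nonneg (inv_nonneg.2 hn.le) (h0 1)
      · simp only [coeff_X_mul, coeff_derivative, coeff_X_pow_mul']
        have := mul_nonneg (inv_nonneg.2 hn.le) (mul_nonneg (h0 2) zero_le_two)
        have h3 := h0 0
        simp at this ⊢
        linarith
      · rw [coeff_X_mul, coeff_X_pow_mul, coeff_derivative, coeff_derivative]
        have a1 := h0 (k + 1)
        have a2 := h0 (k + 1 + 1 + 1)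
        by_cases hk : n < k + 1
        · rw [h1 _ hk]
          have : 0 ≤ (n + 2 : ℝ)⁻¹ * ((cscPoly n).coeff (k + 1 + 1 + 1) * (k + 1 + 1 + 1)) := by
            positivity
          push_cast; linarith
        · have hk' : ((k : ℝ) + 1) ≤ n := by exact_mod_cast not_lt.1 hk
          have : (cscPoly n).coeff (k + 1) + (n + 2 : ℝ)⁻¹ *
              ((cscPoly n).coeff (k + 1 + 1 + 1) * (((k + 1 + 1 : ℕ) : ℝ) + 1)
                - (cscPoly n).coeff (k + 1) * (k + 1)) = (n + 2 : ℝ)⁻¹ *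
              ((cscPoly n).coeff (k + 1 + 1 + 1) * (((k + 1 + 1 : ℕ) : ℝ) + 1)
                + (cscPoly n).coeff (k + 1) * (n + 2 - (k + 1))) := by
            field_simp; ring
          rw [this]
          have : (0 : ℝ) ≤ n + 2 - (k + 1) := by linarith
          positivity
    · rw [e]
      rcases k with _ | _ | k
      · omega
      · omega
      · rw [coeff_X_mul, coeff_X_pow_mul, coeff_derivative, coeff_derivative, h1 (k + 1) (by omega),
          h1 (k + 1 + 1 + 1) (by omega)]
        simp

theorem cscPoly_eval_one (n : ℕ) : (cscPoly n).eval 1 = 1 := by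
  induction n with
  | zero => simp [cscPoly]
  | succ n ih => simp [cscPoly, ih]

open Polynomial in
theorem cscPoly_comp_neg (n : ℕ) : (cscPoly n).comp (-X) = (-1) ^ n * cscPoly n := by
  induction n with
  | zero => simp [cscPoly]
  | succ n ih =>
    have hd := congrArg derivative ih
    rw [derivative_comp] at hd
    have h2 : derivative (((-1) ^ n : ℝ[X]) * cscPoly n) = (-1) ^ n * derivative (cscPoly n) := by
      have : ((-1) ^ n : ℝ[X]) = C ((-1) ^ n) := by simp
      rw [this, derivative_C_mul]
    rw [h2] at hd
    simp only [derivative_neg, derivative_X] at hd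
    rw [cscPoly, add_comp, mul_comp, mul_comp, mul_comp, ih, X_comp, C_comp, sub_comp, pow_comp,
      X_comp, one_comp]
    have : (derivative (cscPoly n)).comp (-X) = -((-1) ^ n * derivative (cscPoly n)) := by
      rw [← hd]; ring
    rw [this]; ring

-- The polynomial is even, so `x` may be replaced by `|x|`; nonnegative coefficients make it
-- monotone on `[0,1]`, and the value at `1` is `1`.
open Polynomial in
theorem cscPoly_eval_bounds (n : ℕ) {x : ℝ} (h : |x| ≤ 1) :
    (cscPoly (2 * n)).eval 0 ≤ (cscPoly (2 * n)).eval x ∧ (cscPoly (2 * n)).eval x ≤ 1 := by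
  have hx : (cscPoly (2 * n)).eval x = (cscPoly (2 * n)).eval |x| := by
    rcases abs_choice x with h | h <;> rw [h]
    have := congrArg (eval x) (cscPoly_comp_neg (2 * n))
    simp [eval_comp, pow_mul] at this
    exact this.symm
  rw [hx]
  have h0 := (cscPoly_coeff_nonneg (2 * n)).1
  constructor
  · rw [eval_eq_sum_range, eval_eq_sum_range]
    refine Finset.sum_le_sum fun k _ => mul_le_mul_of_nonneg_left ?_ (h0 k)
    exact pow_le_pow_left₀ le_rfl (abs_nonneg x) k
  · rw [← cscPoly_eval_one (2 * n), eval_eq_sum_range, eval_eq_sum_range]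
    refine Finset.sum_le_sum fun k _ => mul_le_mul_of_nonneg_left ?_ (h0 k)
    exact pow_le_pow_left₀ (abs_nonneg x) h k

theorem summable_inv_add_int_pow (n : ℕ) (x : ℝ) :
    Summable fun k : ℤ => ((x + k) ^ (n + 2))⁻¹ := by
  have := EisensteinSeries.linear_right_summable x 1 (k := (n + 2 : ℕ)) (by push_cast; omega)
  rw [← Complex.summable_ofReal]
  refine this.congr fun k => ?_
  push_cast
  rw [one_mul]; norm_cast

theorem hasDerivAt_tsum_inv_add_int_pow (n : ℕ) {x : ℝ} (hx : x ∈ Set.Ioo (0 : ℝ) 1) :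
    HasDerivAt (fun y : ℝ => ∑' k : ℤ, ((y + k) ^ (n + 2))⁻¹)
      (-(n + 2) * ∑' k : ℤ, ((x + k) ^ (n + 3))⁻¹) x := by
  rw [← tsum_mul_left]
  obtain ⟨u, hu, hux⟩ := exists_between hx.1
  obtain ⟨v, hxv, hv⟩ := exists_between hx.2
  -- The pole `-k` lies outside `[u,v]`, so `|y + k|` is at least its value at `u` (for `k ≥ 0`) or
  -- at `v` (for `k < 0`). This gives a summable majorant for the differentiated series, uniform on
  -- `(u,v)`.
  have key : ∀ k : ℤ, ∀ y ∈ Set.Ioo u v, (u + k ≤ y + k ∧ 0 < u + k) ∨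
      (y + k ≤ v + k ∧ v + k < 0) := by
    intro k y hy
    rcases le_or_gt 0 k with h | h
    · left
      have : (0 : ℝ) ≤ k := by exact_mod_cast h
      constructor <;> linarith [hy.1]
    · right
      have : (k : ℝ) ≤ -1 := by exact_mod_cast Int.le_sub_one_of_lt h
      constructor <;> linarith [hy.2]
  refine hasDerivAt_tsum_of_isPreconnected
    (u := fun k : ℤ => (n + 2 : ℝ) * (|((u + k) ^ (n + 3))⁻¹| + |((v + k) ^ (n + 3))⁻¹|))
    (t := Set.Ioo u v) (g := fun (k : ℤ) (y : ℝ) => ((y + k) ^ (n + 2))⁻¹)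
    (g' := fun (k : ℤ) (y : ℝ) => -(n + 2 : ℝ) * ((y + k) ^ (n + 3))⁻¹) ?_ isOpen_Ioo
    isPreconnected_Ioo ?_ ?_ (⟨hux, hxv⟩ : x ∈ Set.Ioo u v) (summable_inv_add_int_pow n x)
    ⟨hux, hxv⟩
  · exact (((summable_inv_add_int_pow (n + 1) u).abs).add
      ((summable_inv_add_int_pow (n + 1) v).abs)).mul_left _
  · intro k y hy
    have hne : y + k ≠ 0 := by
      rcases key k y hy with h | h <;> intro h' <;> linarith
    have h1 : HasDerivAt (fun y : ℝ => (y + k) ^ (n + 2)) (((n + 2 : ℕ) : ℝ) * (y + k) ^ (n + 1) * 1) y :=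
      ((hasDerivAt_id y).add_const _).pow (n + 2)
    refine (h1.inv (pow_ne_zero _ hne)).congr_deriv ?_
    field_simp
    push_cast
    ring
  · intro k y hy
    rw [norm_mul, norm_neg, Real.norm_of_nonneg (by positivity : (0 : ℝ) ≤ n + 2)]
    refine mul_le_mul_of_nonneg_left ?_ (by positivity)
    rw [Real.norm_eq_abs]
    simp only [abs_inv, abs_pow]
    rcases key k y hy with h | h
    · have : ((|y + k|) ^ (n + 3))⁻¹ ≤ (|u + k| ^ (n + 3))⁻¹ := by
        refine inv_anti₀ (by have := h.2; positivity) (pow_le_pow_left₀ (abs_nonneg _) ?_ _)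
        rw [abs_of_pos h.2, abs_of_pos (h.2.trans_le h.1)]; exact h.1
      have h2 : 0 ≤ (|v + k| ^ (n + 3))⁻¹ := by positivity
      linarith
    · have : ((|y + k|) ^ (n + 3))⁻¹ ≤ (|v + k| ^ (n + 3))⁻¹ := by
        refine inv_anti₀ (by have := h.2.ne; positivity) (pow_le_pow_left₀ (abs_nonneg _) ?_ _)
        rw [abs_of_neg h.2, abs_of_neg (h.1.trans_lt h.2)]; linarith [h.1]
      have h2 : 0 ≤ (|u + k| ^ (n + 3))⁻¹ := by positivity
      linarith

/-- Differentiating the identity for the exponent `n + 2` and using `1 - cos² = sin²` produces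
exactly the recursion of `cscPoly`. The base case is a hypothesis because it is obtained later from
the box spline. -/
theorem tsum_inv_add_int_pow_eq
    (h2 : ∀ x ∈ Set.Ioo (0 : ℝ) 1, ∑' k : ℤ, ((x + k) ^ 2)⁻¹ = (Real.pi / Real.sin (Real.pi * x)) ^ 2)
    (n : ℕ) : ∀ x ∈ Set.Ioo (0 : ℝ) 1, ∑' k : ℤ, ((x + k) ^ (n + 2))⁻¹ =
      (Real.pi / Real.sin (Real.pi * x)) ^ (n + 2) *
        (cscPoly n).eval (Real.cos (Real.pi * x)) := by
  induction n with
  | zero => intro x hx; simp [h2 x hx, cscPoly]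
  | succ n ih =>
    intro x hx
    have hs : 0 < Real.sin (Real.pi * x) :=
      Real.sin_pos_of_pos_of_lt_pi (mul_pos Real.pi_pos hx.1)
        (by nlinarith [hx.2, Real.pi_pos])
    have d1 := hasDerivAt_tsum_inv_add_int_pow n hx
    have hid : HasDerivAt (fun y : ℝ => Real.pi * y) Real.pi x := by
      simpa using (hasDerivAt_id x).const_mul Real.pi
    have dsin : HasDerivAt (fun y : ℝ => Real.sin (Real.pi * y))
      (Real.cos (Real.pi * x) * Real.pi) x := hid.sin
    have dcos : HasDerivAt (fun y : ℝ => Real.cos (Real.pi * y))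
      (-Real.sin (Real.pi * x) * Real.pi) x := hid.cos
    have dp := ((cscPoly n).hasDerivAt (Real.cos (Real.pi * x))).comp x dcos
    have dq := ((dsin.inv hs.ne').const_mul Real.pi).pow (n + 2)
    have d2 := dq.mul dp
    have d3 := d1.congr_of_eventuallyEq (f₁ := fun y => (Real.pi / Real.sin (Real.pi * y)) ^ (n + 2) *
        (cscPoly n).eval (Real.cos (Real.pi * y))) (by
      filter_upwards [isOpen_Ioo.mem_nhds hx] with y hy
      exact (ih y hy).symm)
    have e := d3.unique d2
    have hn : (n + 2 : ℝ) ≠ 0 := by positivity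
    rw [← mul_right_inj' (neg_ne_zero.2 hn), e]
    simp only [cscPoly, Polynomial.eval_add, Polynomial.eval_mul, Polynomial.eval_X,
      Polynomial.eval_C, Polynomial.eval_sub, Polynomial.eval_one, Polynomial.eval_pow,
      Function.comp_apply, Pi.pow_apply, Pi.inv_apply]
    have hc := Real.sin_sq_add_cos_sq (Real.pi * x)
    have hc' : 1 - Real.cos (Real.pi * x) ^ 2 = Real.sin (Real.pi * x) ^ 2 := by linarith
    rw [hc']
    generalize Real.sin (Real.pi * x) = s at *
    generalize Real.cos (Real.pi * x) = c at *
    generalize (cscPoly n).eval c = p at *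
    generalize (Polynomial.derivative (cscPoly n)).eval c = q at *
    push_cast
    rw [← div_eq_mul_inv]
    -- With `u = π / s` as a free variable and `π` replaced by `u * s`, the claim becomes an
    -- algebraic identity in `u`, `s`, `c`, `p`, `q`.
    have hpi : Real.pi = Real.pi / s * s := by field_simp
    generalize Real.pi / s = u at hpi ⊢
    rw [hpi]
    clear * - hs hn
    field_simp
    ring

end SplineSampling

/-! ### Basic properties and Fourier transform of the B-splines -/

namespace SplineSampling

open MeasureTheory intervalIntegral

theorem bspline_one : bspline 1 = Set.indicator (Set.Ico 0 1) (fun _ => 1) := rfl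

theorem bspline_succ (m : ℕ) (t : ℝ) :
    bspline (m + 2) t = ∫ y in (t - 1)..t, bspline (m + 1) y := by
  have h : (fun y : ℝ => bspline (m + 1) (t - y) *
      Set.indicator (Set.Ico (0 : ℝ) 1) (fun _ => (1 : ℝ)) y) =
      Set.indicator (Set.Ico (0 : ℝ) 1) (fun y => bspline (m + 1) (t - y)) := by
    ext y
    by_cases hy : y ∈ Set.Ico (0 : ℝ) 1 <;> simp [hy]
  rw [bspline]
  beta_reduce
  rw [h, MeasureTheory.integral_indicator measurableSet_Ico, integral_Ico_eq_integral_Ioc,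
    ← integral_of_le zero_le_one, integral_comp_sub_left (fun y => bspline (m + 1) y) t, sub_zero]

theorem bspline_basic (m : ℕ) : Measurable (bspline (m + 1)) ∧
    (∀ x, 0 ≤ bspline (m + 1) x ∧ bspline (m + 1) x ≤ 1) ∧
    ∀ x, x ∉ Set.Icc (0 : ℝ) (m + 1) → bspline (m + 1) x = 0 := by
  induction m with
  | zero =>
    refine ⟨measurable_const.indicator measurableSet_Ico, fun x => ?_, fun x hx => ?_⟩
    · by_cases h : x ∈ Set.Ico (0 : ℝ) 1 <;> simp [bspline_one, h]
    · have : x ∉ Set.Ico (0 : ℝ) 1 := fun h => hx ⟨h.1, by simpa using h.2.le⟩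
      simp [bspline_one, this]
  | succ m ih =>
    obtain ⟨hm, hb, hs⟩ := ih
    have hint : ∀ a b, IntervalIntegrable (bspline (m + 1)) volume a b := fun a b =>
      (intervalIntegrable_const (c := (1 : ℝ))).mono_fun hm.aestronglyMeasurable
        (Filter.Eventually.of_forall fun x => by
          beta_reduce
          rw [Real.norm_of_nonneg (hb x).1, norm_one]; exact (hb x).2)
    refine ⟨?_, fun x => ⟨?_, ?_⟩, fun x hx => ?_⟩
    · have : bspline (m + 2) = fun t => (∫ y in (0:ℝ)..t, bspline (m + 1) y) -
          ∫ y in (0:ℝ)..(t - 1), bspline (m + 1) y := by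
        ext t
        rw [bspline_succ, integral_interval_sub_left (hint _ _) (hint _ _)]
      rw [this]
      have hc := continuous_primitive hint 0
      exact (hc.sub (hc.comp (continuous_id.sub continuous_const))).measurable
    · rw [bspline_succ]
      exact integral_nonneg (by linarith) fun y _ => (hb y).1
    · rw [bspline_succ]
      have := integral_mono_on (by linarith : x - 1 ≤ x) (hint _ _)
        (intervalIntegrable_const (c := (1 : ℝ))) fun y _ => (hb y).2
      simpa using this
    · rw [bspline_succ, integral_of_le (by linarith)]
      refine setIntegral_eq_zero_of_forall_eq_zero fun y hy => hs y fun hc => hx ?_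
      exact ⟨hc.1.trans hy.2, by push_cast; linarith [hc.2, hy.1]⟩

theorem intervalIntegrable_bspline (m : ℕ) (a b : ℝ) :
    IntervalIntegrable (bspline (m + 1)) volume a b :=
  (intervalIntegrable_const (c := (1 : ℝ))).mono_fun
    (bspline_basic m).1.aestronglyMeasurable
    (Filter.Eventually.of_forall fun x => by
      beta_reduce
      rw [Real.norm_of_nonneg ((bspline_basic m).2.1 x).1, norm_one]
      exact ((bspline_basic m).2.1 x).2)

theorem bspline_eq_primitive_sub (m : ℕ) :
    bspline (m + 2) = fun t => (∫ y in (0:ℝ)..t, bspline (m + 1) y) -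
      ∫ y in (0:ℝ)..(t - 1), bspline (m + 1) y := by
  ext t
  rw [bspline_succ, integral_interval_sub_left (intervalIntegrable_bspline m _ _)
    (intervalIntegrable_bspline m _ _)]

/-- Induction on `Q_{n+1}'(t) = Q_n(t) - Q_n(t - 1)`, valid once `Q_n` is continuous. -/
theorem contDiff_bspline (m : ℕ) : ContDiff ℝ m (bspline (m + 2)) := by
  induction m with
  | zero =>
    rw [Nat.cast_zero, contDiff_zero, bspline_eq_primitive_sub]
    have hc := continuous_primitive (intervalIntegrable_bspline 0) 0
    exact hc.sub (hc.comp (continuous_id.sub continuous_const))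
  | succ m ih =>
    have hd : ∀ t, HasDerivAt (fun t => ∫ y in (0:ℝ)..t, bspline (m + 2) y) (bspline (m + 2) t) t :=
      fun t => integral_hasDerivAt_right (intervalIntegrable_bspline (m + 1) _ _)
        (bspline_basic (m + 1)).1.stronglyMeasurable.stronglyMeasurableAtFilter
        ih.continuous.continuousAt
    have hd2 : ∀ t, HasDerivAt (bspline (m + 3)) (bspline (m + 2) t - bspline (m + 2) (t - 1)) t := by
      intro t
      rw [bspline_eq_primitive_sub]
      exact (hd t).sub (HasDerivAt.comp_sub_const t 1 (hd (t - 1)))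
    rw [Nat.cast_succ, contDiff_succ_iff_deriv]
    refine ⟨fun t => (hd2 t).differentiableAt, by simp, ?_⟩
    rw [funext fun t => (hd2 t).deriv]
    exact ih.sub (ih.comp (contDiff_id.sub contDiff_const))

theorem integrable_bspline (m : ℕ) : Integrable (bspline (m + 1)) := by
  have h := (intervalIntegrable_bspline m (-1) (m + 1)).1
  refine (integrableOn_iff_integrable_of_support_subset ?_).1 h
  intro x hx
  by_contra hc
  refine hx ((bspline_basic m).2.2 x fun h => hc ⟨by linarith [h.1], h.2⟩)

open FourierTransform in
theorem fourier_bspline (m : ℕ) (ξ : ℝ) :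
    𝓕 (fun t => (bspline (m + 1) t : ℂ)) ξ = (𝓕 (fun t => (bspline 1 t : ℂ)) ξ) ^ (m + 1) := by
  induction m with
  | zero => simp
  | succ m ih =>
    have h := Real.fourier_mul_convolution_eq (R := ℂ) (f₁ := fun t => (bspline 1 t : ℂ))
      (f₂ := fun t => (bspline (m + 1) t : ℂ)) (integrable_bspline 0).ofReal
      (integrable_bspline m).ofReal ξ
    rw [ih, ← pow_succ'] at h
    rw [← h]
    refine congrFun (congrArg _ (funext fun t => ?_)) ξ
    rw [convolution_def, show bspline (m + 1 + 1) t = ∫ y : ℝ, bspline (m + 1) (t - y) *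
      Set.indicator (Set.Ico (0 : ℝ) 1) (fun _ => (1 : ℝ)) y from rfl, ← integral_complex_ofReal]
    refine integral_congr_ae (Filter.Eventually.of_forall fun y => ?_)
    simp [bspline_one, mul_comm]

-- The transform of the box is `(e^{-2πiξ} - 1) / (-2πiξ)`, of modulus `|sin πξ| / (π|ξ|)`;
-- convolution turns into powers.
open FourierTransform in
theorem norm_sq_fourier_bspline (m : ℕ) {ξ : ℝ} (hξ : ξ ≠ 0) :
    ‖𝓕 (fun t => (bspline (m + 1) t : ℂ)) ξ‖ ^ 2 =
      (Real.sin (Real.pi * ξ) / Real.pi) ^ (2 * (m + 1)) * (ξ ^ (2 * (m + 1)))⁻¹ := by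
  have h1 : 𝓕 (fun t => (bspline 1 t : ℂ)) ξ =
      ∫ x in (0:ℝ)..1, Complex.exp ((-2 * Real.pi * ξ * Complex.I) * x) := by
    rw [Real.fourier_real_eq_integral_exp_smul, integral_of_le zero_le_one,
      ← integral_Ico_eq_integral_Ioc, ← MeasureTheory.integral_indicator measurableSet_Ico]
    congr 1
    ext x
    by_cases h : x ∈ Set.Ico (0 : ℝ) 1
    · simp only [bspline_one, h, Set.indicator_of_mem, Complex.ofReal_one, smul_eq_mul, mul_one]
      congr 1; push_cast; ring
    · simp [bspline_one, h]
  have hc : (-2 * Real.pi * ξ * Complex.I : ℂ) ≠ 0 := by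
    simp [hξ, Real.pi_ne_zero]
  rw [fourier_bspline, h1, integral_exp_mul_complex hc]
  have h2 : ‖Complex.exp (-2 * Real.pi * ξ * Complex.I) - 1‖ = 2 * |Real.sin (Real.pi * ξ)| := by
    have := Complex.norm_exp_I_mul_ofReal_sub_one (-2 * Real.pi * ξ)
    push_cast at this
    rw [mul_comm Complex.I] at this
    rw [this, show -2 * Real.pi * ξ / 2 = -(Real.pi * ξ) by ring, Real.sin_neg]
    simp
  have h3 : ‖(-2 * Real.pi * ξ * Complex.I : ℂ)‖ = 2 * Real.pi * |ξ| := by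
    simp [abs_of_pos Real.pi_pos]
  simp only [Complex.ofReal_one, mul_one, Complex.ofReal_zero, mul_zero, Complex.exp_zero]
  rw [norm_pow, norm_div, h2, h3, ← pow_mul, mul_comm (m + 1) 2, ← inv_pow, ← mul_pow, pow_mul,
    pow_mul]
  congr 1
  rw [div_pow, mul_pow, sq_abs, mul_pow, mul_pow, sq_abs]
  have := Real.pi_ne_zero
  field_simp

end SplineSampling

/-! ### Zak transform and the Krein-Favard constant -/

namespace SplineSampling

open MeasureTheory intervalIntegral FourierTransform

/-- The Zak transform of the B-spline `Q_m`. -/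
noncomputable def splineZak (m : ℕ) (x : ℝ) (t : UnitAddCircle) : ℂ :=
  ∑ k ∈ Finset.Icc (-1 : ℤ) m, (bspline m (x + k) : ℂ) * fourier k t

/-- The finite range in `splineZak` therefore loses nothing for `x ∈ (0,1]`. -/
theorem bspline_add_int_eq_zero (m : ℕ) {x : ℝ} (hx : x ∈ Set.Ioc (0 : ℝ) 1) {k : ℤ}
    (hk : k ∉ Finset.Icc (-1 : ℤ) (m + 1 : ℕ)) : bspline (m + 1) (x + k) = 0 := by
  refine (bspline_basic m).2.2 _ fun h => hk ?_
  rw [Finset.mem_Icc]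
  constructor
  · have : (-1 : ℝ) ≤ k := by linarith [h.1, hx.2]
    exact_mod_cast this
  · have : (k : ℝ) ≤ (m + 1 : ℕ) := by push_cast; linarith [h.2, hx.1]
    exact_mod_cast this

/-- On the unit interval, the periodization of `Q(x) e^{2πixτ}` is the Zak transform times a
unimodular phase, and its Fourier coefficients are the values `Q̂(n - τ)`; the claim is Parseval. -/
theorem hasSum_norm_sq_fourier_bspline (m : ℕ) (τ : ℝ) :
    HasSum (fun n : ℤ => ‖𝓕 (fun t => (bspline (m + 1) t : ℂ)) (n - τ)‖ ^ 2)
      (∫ x in (0:ℝ)..1, ‖splineZak (m + 1) x (τ : UnitAddCircle)‖ ^ 2) := by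
  set s := Finset.Icc (-1 : ℤ) (m + 1 : ℕ)
  set R : ℝ → ℂ := fun x => ∑ k ∈ s, (bspline (m + 1) (x + k) : ℂ) *
    Complex.exp (2 * Real.pi * Complex.I * ((x + k) * τ)) with hR
  have hnorm : ∀ x, ‖R x‖ = ‖splineZak (m + 1) x (τ : UnitAddCircle)‖ := by
    intro x
    have : R x = Complex.exp ((2 * Real.pi * (x * τ) : ℝ) * Complex.I) *
        splineZak (m + 1) x (τ : UnitAddCircle) := by
      rw [splineZak, Finset.mul_sum]
      refine Finset.sum_congr rfl fun k _ => ?_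
      rw [fourier_coe_apply, mul_left_comm (Complex.exp _), ← Complex.exp_add]
      congr 2
      push_cast; ring
    rw [this, norm_mul, Complex.norm_exp_ofReal_mul_I, one_mul]
  have hmeas : Measurable R := by
    refine Finset.measurable_fun_sum _ fun k _ => Measurable.mul ?_ (by fun_prop)
    exact Complex.measurable_ofReal.comp ((bspline_basic m).1.comp (measurable_id.add_const _))
  have hbound : ∀ x, ‖R x‖ ≤ s.card := by
    intro x
    refine (norm_sum_le _ _).trans ?_
    rw [Finset.card_eq_sum_ones, Nat.cast_sum]
    refine Finset.sum_le_sum fun k _ => ?_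
    have : (2 * Real.pi * Complex.I * ((x + k) * τ) : ℂ) =
      (2 * Real.pi * ((x + k) * τ) : ℝ) * Complex.I := by push_cast; ring
    rw [norm_mul, this, Complex.norm_exp_ofReal_mul_I, mul_one, Complex.norm_real,
      Real.norm_of_nonneg ((bspline_basic m).2.1 _).1, Nat.cast_one]
    exact ((bspline_basic m).2.1 _).2
  have hL2 : MemLp R 2 (volume.restrict (Set.Ioc 0 1)) :=
    MemLp.of_bound hmeas.aestronglyMeasurable s.card (Filter.Eventually.of_forall hbound)
  have h := hasSum_sq_fourierCoeffOn (zero_lt_one' ℝ) hL2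
  simp only [sub_zero, inv_one, one_smul, hnorm] at h
  convert h using 2 with n
  congr 2
  rw [fourierCoeffOn_eq_integral, Real.fourier_real_eq_integral_exp_smul]
  set g : ℝ → ℂ := fun v => Complex.exp (↑(-2 * Real.pi * v * (n - τ)) * Complex.I) •
    (bspline (m + 1) v : ℂ) with hg
  have hgi : Integrable g := by
    refine ((integrable_bspline m).ofReal (𝕜 := ℂ)).bdd_smul (𝕜 := ℂ) 1
      (Continuous.aestronglyMeasurable (by fun_prop)) (Filter.Eventually.of_forall fun v => ?_)
    rw [Complex.norm_exp_ofReal_mul_I]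
  have h1 := hgi.hasSum_intervalIntegral_comp_add_int
  have h2 : HasSum (fun k : ℤ => ∫ x in (0:ℝ)..1, g (x + k)) (∑ k ∈ s, ∫ x in (0:ℝ)..1, g (x + k)) := by
    refine hasSum_sum_of_ne_finset_zero fun k hk => ?_
    rw [integral_of_le zero_le_one]
    refine setIntegral_eq_zero_of_forall_eq_zero fun x hx => ?_
    simp [hg, bspline_add_int_eq_zero m hx hk]
  rw [h1.unique h2, ← intervalIntegral.integral_finsetSum]
  · simp only [sub_zero, div_one, one_smul]
    refine integral_congr fun x _ => ?_
    simp only [hg, hR, smul_eq_mul, Finset.mul_sum]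
    refine Finset.sum_congr rfl fun k _ => ?_
    rw [fourier_coe_apply, mul_comm (bspline _ _ : ℂ), ← mul_assoc, ← Complex.exp_add]
    congr 1
    -- The phases agree up to `e^{-2πikn} = 1`.
    rw [Complex.exp_eq_exp_iff_exists_int]
    refine ⟨-(k * n), ?_⟩
    push_cast; ring
  · exact fun k _ => (hgi.comp_add_right (k : ℝ)).intervalIntegrable

theorem integral_norm_sq_splineZak_eq_tsum (m : ℕ) {τ : ℝ} (hτ : τ ∈ Set.Ioo (0 : ℝ) 1) :
    ∫ x in (0:ℝ)..1, ‖splineZak (m + 1) x (τ : UnitAddCircle)‖ ^ 2 =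
      (Real.sin (Real.pi * τ) / Real.pi) ^ (2 * (m + 1)) *
        ∑' k : ℤ, ((τ + k) ^ (2 * (m + 1)))⁻¹ := by
  rw [← (hasSum_norm_sq_fourier_bspline m τ).tsum_eq, ← tsum_mul_left, ← (Equiv.neg ℤ).tsum_eq]
  refine tsum_congr fun k => ?_
  have hne : ((Equiv.neg ℤ k : ℤ) : ℝ) - τ ≠ 0 := by
    intro h
    have h' : τ = ((Equiv.neg ℤ k : ℤ) : ℝ) := by linarith
    rw [h'] at hτ
    have h1 : 0 < Equiv.neg ℤ k := by exact_mod_cast hτ.1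
    have h2 : Equiv.neg ℤ k < 1 := by exact_mod_cast hτ.2
    omega
  rw [norm_sq_fourier_bspline m hne]
  have e1 : ((Equiv.neg ℤ k : ℤ) : ℝ) - τ = -(τ + k) := by simp; ring
  have e2 : Real.sin (Real.pi * -(τ + k)) ^ 2 = Real.sin (Real.pi * τ) ^ 2 := by
    rw [show Real.pi * -(τ + k) = -(Real.pi * τ + k * Real.pi) by ring, Real.sin_neg, neg_sq,
      Real.sin_add_int_mul_pi, mul_pow]
    have : ((-1 : ℝ) ^ k) ^ 2 = 1 := by
      rw [← zpow_natCast, ← zpow_mul, mul_comm, zpow_mul]; simp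
    rw [this, one_mul]
  rw [e1, pow_mul, div_pow, e2, ← div_pow, ← pow_mul, pow_mul (-(τ + k) : ℝ), neg_sq, ← pow_mul]

/-- The box spline has Zak transform `1` on the open unit interval, so the previous identity
evaluates the sum; this is the base case for the higher exponents. -/
theorem tsum_inv_add_int_sq {τ : ℝ} (hτ : τ ∈ Set.Ioo (0 : ℝ) 1) :
    ∑' k : ℤ, ((τ + k) ^ 2)⁻¹ = (Real.pi / Real.sin (Real.pi * τ)) ^ 2 := by
  have h := integral_norm_sq_splineZak_eq_tsum 0 hτ
  have h1 : ∫ x in (0:ℝ)..1, ‖splineZak (0 + 1) x (τ : UnitAddCircle)‖ ^ 2 = 1 := by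
    rw [integral_of_le zero_le_one, integral_Ioc_eq_integral_Ioo]
    rw [setIntegral_congr_fun (g := fun _ => (1 : ℝ)) measurableSet_Ioo]
    · simp
    intro x hx
    have : splineZak (0 + 1) x (τ : UnitAddCircle) = 1 := by
      rw [splineZak, Finset.sum_eq_single 0]
      · simp [bspline_one, hx.1.le, hx.2]
      · intro k _ hk
        have : x + k ∉ Set.Ico (0 : ℝ) 1 := by
          intro hh
          apply hk
          have a1 : (-1 : ℝ) < k := by linarith [hh.1, hx.2]
          have a2 : (k : ℝ) < 1 := by linarith [hh.2, hx.1]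
          have a1' : (-1 : ℤ) < k := by exact_mod_cast a1
          have a2' : (k : ℤ) < 1 := by exact_mod_cast a2
          omega
        simp [bspline_one, this]
      · simp
    simp [this]
  rw [h1] at h
  have hs : 0 < Real.sin (Real.pi * τ) :=
    Real.sin_pos_of_pos_of_lt_pi (mul_pos Real.pi_pos hτ.1) (by nlinarith [hτ.2, Real.pi_pos])
  simp only [zero_add, mul_one] at h
  rw [div_pow] at h ⊢
  have := Real.pi_ne_zero
  field_simp at h ⊢
  linarith

theorem integral_norm_sq_splineZak (m : ℕ) {τ : ℝ} (hτ : τ ∈ Set.Ioo (0 : ℝ) 1) :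
    ∫ x in (0:ℝ)..1, ‖splineZak (m + 1) x (τ : UnitAddCircle)‖ ^ 2 =
      (cscPoly (2 * m)).eval (Real.cos (Real.pi * τ)) := by
  rw [integral_norm_sq_splineZak_eq_tsum m hτ, show 2 * (m + 1) = 2 * m + 2 by ring,
    tsum_inv_add_int_pow_eq (fun x hx => tsum_inv_add_int_sq hx) (2 * m) τ hτ, ← mul_assoc,
    ← mul_pow]
  have hs : 0 < Real.sin (Real.pi * τ) :=
    Real.sin_pos_of_pos_of_lt_pi (mul_pos Real.pi_pos hτ.1) (by nlinarith [hτ.2, Real.pi_pos])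
  rw [div_mul_div_cancel₀ Real.pi_ne_zero, div_self hs.ne', one_pow, one_mul]

theorem tsum_odd_pos (m : ℕ) : 0 < ∑' ν : ℕ, (((2 * (ν : ℝ) + 1) ^ (2 * m + 2))⁻¹) := by
  have hs : Summable fun ν : ℕ => ((2 * (ν : ℝ) + 1) ^ (2 * m + 2))⁻¹ := by
    have h := ((summable_inv_add_int_pow (2 * m) (1 / 2)).comp_injective
      Nat.cast_injective).mul_left (((2 : ℝ) ^ (2 * m + 2))⁻¹)
    refine h.congr fun ν => ?_
    simp only [Function.comp_apply, Int.cast_natCast]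
    rw [← mul_inv, ← mul_pow]
    congr 2; ring
  exact hs.tsum_pos (fun ν => by positivity) 0 (by simp)

/-- Evaluation of the lattice sum at `x = 1/2`, where `cos πx = 0` and `sin πx = 1`. The terms `k =
ν` and `k = -(ν+1)` coincide because the exponent is even, hence the factor `2`. -/
theorem cscPoly_eval_zero (m : ℕ) : (cscPoly (2 * m)).eval 0 =
    2 * (2 / Real.pi) ^ (2 * m + 2) * ∑' ν : ℕ, ((2 * (ν : ℝ) + 1) ^ (2 * m + 2))⁻¹ := by
  have h := tsum_inv_add_int_pow_eq (fun x hx => tsum_inv_add_int_sq hx) (2 * m) (1 / 2)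
    ⟨by norm_num, by norm_num⟩
  rw [show Real.pi * (1 / 2) = Real.pi / 2 by ring, Real.sin_pi_div_two, Real.cos_pi_div_two,
    div_one] at h
  have hsum := summable_inv_add_int_pow (2 * m) (1 / 2)
  have e1 : ∀ ν : ℕ, (((1 / 2 : ℝ) + ((ν : ℤ) : ℝ)) ^ (2 * m + 2))⁻¹ =
      2 ^ (2 * m + 2) * ((2 * (ν : ℝ) + 1) ^ (2 * m + 2))⁻¹ := by
    intro ν
    rw [show (1 / 2 : ℝ) + ((ν : ℤ) : ℝ) = (2 * ν + 1) / 2 by push_cast; ring, div_pow, inv_div,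
      div_eq_mul_inv]
  have e2 : ∀ ν : ℕ, (((1 / 2 : ℝ) + ((-((ν : ℤ) + 1) : ℤ) : ℝ)) ^ (2 * m + 2))⁻¹ =
      2 ^ (2 * m + 2) * ((2 * (ν : ℝ) + 1) ^ (2 * m + 2))⁻¹ := by
    intro ν
    rw [show (1 / 2 : ℝ) + ((-((ν : ℤ) + 1) : ℤ) : ℝ) = -((2 * ν + 1) / 2) by push_cast; ring,
      Even.neg_pow ⟨m + 1, by ring⟩, div_pow, inv_div, div_eq_mul_inv]
  have i1 : Function.Injective (fun ν : ℕ => (ν : ℤ)) := Nat.cast_injective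
  have i2 : Function.Injective (fun ν : ℕ => -((ν : ℤ) + 1)) := by
    intro a b hab; simp only at hab; omega
  have h3 := tsum_of_nat_of_neg_add_one
    (f := fun k : ℤ => (((1 / 2 : ℝ) + k) ^ (2 * m + 2))⁻¹) (hsum.comp_injective i1)
    (hsum.comp_injective i2)
  rw [h3] at h
  simp only [e1, e2, tsum_mul_left] at h
  have hpi : Real.pi ^ (2 * m + 2) ≠ 0 := pow_ne_zero _ Real.pi_ne_zero
  rw [div_pow, mul_div_assoc', div_mul_eq_mul_div, eq_div_iff hpi]
  linarith

/-- For the odd index `2m + 1` the signs in the Favard series are all positive, leaving the series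
of `cscPoly_eval_zero`. -/
theorem favard_factor (m : ℕ) : Real.pi ^ (2 * (m + 1) - 1) /
    (2 ^ (2 * (m + 1) - 1) * favardConst (2 * (m + 1) - 1)) = ((cscPoly (2 * m)).eval 0)⁻¹ := by
  rw [show 2 * (m + 1) - 1 = 2 * m + 1 by omega, cscPoly_eval_zero, favardConst]
  have : ∀ ν : ℕ, (-1 : ℝ) ^ (ν * (2 * m + 1 + 1)) / (2 * (ν : ℝ) + 1) ^ (2 * m + 1 + 1) =
      ((2 * (ν : ℝ) + 1) ^ (2 * m + 2))⁻¹ := by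
    intro ν
    rw [Even.neg_one_pow ⟨ν * (m + 1), by ring⟩, one_div]
  simp only [this]
  have h0 := (tsum_odd_pos m).ne'
  generalize (∑' ν : ℕ, ((2 * (ν : ℝ) + 1) ^ (2 * m + 2))⁻¹) = S at h0 ⊢
  have hpi := Real.pi_ne_zero
  rw [div_pow, show 2 * m + 2 = 2 * m + 1 + 1 by ring, pow_succ 2, pow_succ Real.pi]
  field_simp
  ring

theorem cscPoly_eval_zero_pos (m : ℕ) : 0 < (cscPoly (2 * m)).eval 0 := by
  rw [cscPoly_eval_zero]
  have := tsum_odd_pos m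
  have := Real.pi_pos
  positivity

end SplineSampling

/-! ### Parseval on the circle and the Riesz bounds of the translates -/

namespace SplineSampling

open MeasureTheory AddCircle
open scoped ENNReal

/-- Riesz-Fischer. The strongly measurable representative is wanted for the Tonelli argument below.
-/
theorem exists_memLp_fourierCoeff_eq {c : ℤ → ℂ} (hc : Summable fun k => ‖c k‖ ^ 2) :
    ∃ F : UnitAddCircle → ℂ, StronglyMeasurable F ∧ MemLp F 2 haarAddCircle ∧
      ∀ k, fourierCoeff F k = c k := by
  have hm : Memℓp c 2 := memℓp_gen (by simpa using hc)
  let G := (fourierBasis (T := (1 : ℝ))).repr.symm ⟨c, hm⟩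
  refine ⟨G, Lp.stronglyMeasurable G, Lp.memLp G, fun k => ?_⟩
  rw [← fourierBasis_repr]
  simp [G]

theorem hasSum_sq_fourierCoeff_of_memLp {F : UnitAddCircle → ℂ} (hF : MemLp F 2 haarAddCircle) :
    HasSum (fun k => ‖fourierCoeff F k‖ ^ 2) (∫ t, ‖F t‖ ^ 2 ∂haarAddCircle) := by
  have h := hasSum_sq_fourierCoeff hF.toLp
  rw [fourierCoeff_congr_ae hF.coeFn_toLp] at h
  convert h using 1
  refine integral_congr_ae ?_
  filter_upwards [hF.coeFn_toLp] with t ht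
  rw [ht]

theorem integrable_norm_sq {α : Type*} [MeasurableSpace α] {μ : Measure α} {F : α → ℂ}
    (hF : MemLp F 2 μ) : Integrable (fun t => ‖F t‖ ^ 2) μ :=
  hF.integrable_norm_pow (p := 2) two_ne_zero

theorem tsum_enorm_sq_fourierCoeff {F : UnitAddCircle → ℂ} (hF : MemLp F 2 haarAddCircle) :
    ∑' k, ‖fourierCoeff F k‖ₑ ^ 2 = ∫⁻ t, ‖F t‖ₑ ^ 2 ∂haarAddCircle := by
  have h := hasSum_sq_fourierCoeff_of_memLp hF
  have e : ∀ z : ℂ, ‖z‖ₑ ^ 2 = ENNReal.ofReal (‖z‖ ^ 2) := fun z => by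
    rw [ENNReal.ofReal_pow (norm_nonneg _), ofReal_norm]
  simp only [e]
  rw [← ENNReal.ofReal_tsum_of_nonneg (fun k => sq_nonneg _) h.summable, h.tsum_eq,
    ofReal_integral_eq_lintegral_ofReal (integrable_norm_sq hF)
      (Filter.Eventually.of_forall fun t => sq_nonneg _)]

theorem memLp_continuous_mul {g : UnitAddCircle → ℂ} (hg : Continuous g) {F : UnitAddCircle → ℂ}
    (hF : MemLp F 2 haarAddCircle) : MemLp (fun t => g t * F t) 2 haarAddCircle := by
  obtain ⟨M, hM⟩ := isCompact_univ.exists_bound_of_continuousOn hg.continuousOn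
  refine MemLp.of_le_mul (c := M) hF
    (hg.aestronglyMeasurable.mul hF.aestronglyMeasurable)
    (Filter.Eventually.of_forall fun t => ?_)
  rw [norm_mul]
  exact mul_le_mul_of_nonneg_right (hM t trivial) (norm_nonneg _)

theorem fourierCoeff_trigPoly_mul (s : Finset ℤ) (q : ℤ → ℂ) {F : UnitAddCircle → ℂ}
    (hF : MemLp F 2 haarAddCircle) (l : ℤ) :
    fourierCoeff (fun t => (∑ k ∈ s, q k * fourier k t) * F t) l =
      ∑ k ∈ s, q k * fourierCoeff F (l - k) := by
  have hFi : Integrable F haarAddCircle := hF.integrable one_le_two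
  simp only [fourierCoeff, ← integral_const_mul]
  rw [← integral_finsetSum]
  · refine integral_congr_ae (Filter.Eventually.of_forall fun t => ?_)
    simp only [smul_eq_mul, Finset.sum_mul, Finset.mul_sum]
    refine Finset.sum_congr rfl fun k _ => ?_
    rw [show -(l - k) = -l + k by ring, fourier_add]
    ring
  · exact fun k _ => (hFi.fourier_smul _).const_mul _

theorem lintegral_eq_lintegral_tsum_add_int {g : ℝ → ℝ≥0∞} (hg : Measurable g) :
    ∫⁻ x, g x = ∫⁻ x in Set.Ioc (0 : ℝ) 1, ∑' n : ℤ, g (x + n) := by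
  have hm : ∀ n : ℤ, Measurable fun x : ℝ => g (x + n) := fun n => hg.comp (measurable_id.add_const _)
  rw [lintegral_tsum fun n => (hm n).aemeasurable, ← setLIntegral_univ,
    ← iUnion_Ioc_add_intCast (0 : ℝ), lintegral_iUnion (fun n => measurableSet_Ioc)
    (Set.pairwise_disjoint_Ioc_add_intCast (0 : ℝ))]
  refine tsum_congr fun n => ?_
  have h := (measurePreserving_add_right volume (n : ℝ)).setLIntegral_comp_preimage
    (s := Set.Ioc (0 + (n : ℝ)) (0 + n + 1)) measurableSet_Ioc hg
  rw [← h]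
  congr 2
  ext x
  simp only [Set.mem_preimage, Set.mem_Ioc]
  constructor <;> rintro ⟨h1, h2⟩ <;> constructor <;> linarith

theorem measurable_splineZak (m : ℕ) :
    Measurable fun p : ℝ × UnitAddCircle => splineZak (m + 1) p.1 p.2 := by
  refine Finset.measurable_fun_sum _ fun k _ => Measurable.mul ?_ ?_
  · exact Complex.measurable_ofReal.comp
      ((bspline_basic m).1.comp (measurable_fst.add_const _))
  · exact (map_continuous (fourier k)).measurable.comp measurable_snd

/-- For fixed `x ∈ (0,1]` the numbers `f(x + n)` are the Fourier coefficients of `Z(x,·) F`;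
Parseval in `n`, then Tonelli in `(x,t)`. Lower integrals are used so that square integrability of
`f` can be a consequence. -/
theorem lintegral_spline_enorm_sq (m : ℕ) {c : ℤ → ℂ} {F : UnitAddCircle → ℂ}
    (hFm : StronglyMeasurable F) (hF : MemLp F 2 haarAddCircle) (hFc : ∀ k, fourierCoeff F k = c k)
    {f : ℝ → ℂ} (hfm : Measurable f)
    (hf : ∀ x : ℝ, HasSum (fun k : ℤ => c k * (bspline (m + 1) (x - k) : ℂ)) (f x)) :
    ∫⁻ x, ‖f x‖ₑ ^ 2 = ∫⁻ t, ‖F t‖ₑ ^ 2 * (∫⁻ x in Set.Ioc (0 : ℝ) 1,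
      ‖splineZak (m + 1) x t‖ₑ ^ 2) ∂haarAddCircle := by
  rw [lintegral_eq_lintegral_tsum_add_int (hfm.enorm.pow_const 2)]
  have h1 : ∀ x ∈ Set.Ioc (0 : ℝ) 1, ∑' n : ℤ, ‖f (x + n)‖ₑ ^ 2 =
      ∫⁻ t, ‖F t‖ₑ ^ 2 * ‖splineZak (m + 1) x t‖ₑ ^ 2 ∂haarAddCircle := by
    intro x hx
    have hcont : Continuous fun t => splineZak (m + 1) x t :=
      continuous_finsetSum _ fun k _ => continuous_const.mul (map_continuous _)
    have h2 := tsum_enorm_sq_fourierCoeff (memLp_continuous_mul hcont hF)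
    simp only [enorm_mul, mul_pow] at h2
    rw [lintegral_congr fun t => mul_comm (‖F t‖ₑ ^ 2) _, ← h2]
    refine tsum_congr fun n => ?_
    congr 2
    simp only [splineZak]
    rw [fourierCoeff_trigPoly_mul _ _ hF]
    have h3 := hf (x + n)
    rw [← (Equiv.subLeft n).hasSum_iff] at h3
    refine h3.unique ?_
    have h4 : ∀ k : ℤ, ((fun k : ℤ => c k * (bspline (m + 1) (x + n - k) : ℂ)) ∘ Equiv.subLeft n) k
        = (bspline (m + 1) (x + k) : ℂ) * fourierCoeff F (n - k) := by
      intro k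
      simp only [Function.comp_apply, Equiv.subLeft_apply, hFc, mul_comm (c _)]
      congr 3
      push_cast; ring
    rw [funext h4]
    refine hasSum_sum_of_ne_finset_zero fun k hk => ?_
    rw [bspline_add_int_eq_zero m hx hk]; simp
  rw [setLIntegral_congr_fun measurableSet_Ioc h1, lintegral_lintegral_swap]
  · refine lintegral_congr fun t => ?_
    rw [lintegral_const_mul]
    exact ((measurable_splineZak m).comp (measurable_id.prodMk measurable_const)).enorm.pow_const 2
  · exact ((hFm.measurable.comp measurable_snd).enorm.pow_const 2).mul
      ((measurable_splineZak m).enorm.pow_const 2) |>.aemeasurable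

theorem norm_splineZak_le (m : ℕ) (x : ℝ) (t : UnitAddCircle) :
    ‖splineZak (m + 1) x t‖ ≤ (Finset.Icc (-1 : ℤ) (m + 1 : ℕ)).card := by
  refine (norm_sum_le _ _).trans ?_
  rw [Finset.card_eq_sum_ones, Nat.cast_sum]
  refine Finset.sum_le_sum fun k _ => ?_
  rw [norm_mul, Complex.norm_real, Real.norm_of_nonneg ((bspline_basic m).2.1 _).1, Nat.cast_one,
    fourier_apply, Circle.norm_coe, mul_one]
  exact ((bspline_basic m).2.1 _).2

/-- The closed form of the integral is available on `0 < τ < 1` only; the remaining point `t = 0` of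
the circle is null. -/
theorem ae_lintegral_splineZak_bounds (m : ℕ) : ∀ᵐ t : UnitAddCircle ∂haarAddCircle,
    ENNReal.ofReal ((cscPoly (2 * m)).eval 0) ≤
        ∫⁻ x in Set.Ioc (0 : ℝ) 1, ‖splineZak (m + 1) x t‖ₑ ^ 2 ∧
      ∫⁻ x in Set.Ioc (0 : ℝ) 1, ‖splineZak (m + 1) x t‖ₑ ^ 2 ≤ 1 := by
  have hnull : ∀ᵐ t : UnitAddCircle ∂haarAddCircle, t ≠ 0 := by
    rw [ae_iff]
    have : (fun x : ℝ => (x : UnitAddCircle)) ⁻¹' {0} ∩ Set.Ioc 0 1 ⊆ {1} := by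
      rintro x ⟨hx, hx'⟩
      rw [Set.mem_preimage, Set.mem_singleton_iff, AddCircle.coe_eq_zero_iff] at hx
      obtain ⟨n, rfl⟩ := hx
      simp only [zsmul_eq_mul, mul_one, Set.mem_Ioc, Set.mem_singleton_iff] at *
      have h1 : 0 < n := by exact_mod_cast hx'.1
      have h2 : n ≤ 1 := by exact_mod_cast hx'.2
      have : n = 1 := by omega
      simp [this]
    have h0 : volume ({0} : Set UnitAddCircle) = 0 := by
      have := (AddCircle.measurePreserving_mk (1 : ℝ) 0).measure_preimage
        (measurableSet_singleton (0 : AddCircle (1 : ℝ))).nullMeasurableSet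
      rw [← this, zero_add, Measure.restrict_apply' measurableSet_Ioc]
      exact measure_mono_null (by assumption) (measure_singleton _)
    have : (haarAddCircle : Measure UnitAddCircle) ≪ volume := by
      rw [volume_eq_smul_haarAddCircle]
      exact Measure.absolutelyContinuous_smul (by simp)
    simpa using this h0
  filter_upwards [hnull] with t ht
  obtain ⟨τ, ⟨hτ0, hτ1⟩, rfl⟩ : ∃ τ ∈ Set.Ico (0 : ℝ) 1, (τ : UnitAddCircle) = t := by
    have := (AddCircle.equivIco (1 : ℝ) 0 t).2
    refine ⟨AddCircle.equivIco 1 0 t, by simpa using this, ?_⟩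
    exact (AddCircle.equivIco (1 : ℝ) 0).symm_apply_apply t
  have hτ : τ ∈ Set.Ioo (0 : ℝ) 1 := by
    refine ⟨lt_of_le_of_ne hτ0 ?_, hτ1⟩
    rintro rfl
    exact ht rfl
  have h := integral_norm_sq_splineZak m hτ
  have e : ∀ z : ℂ, ‖z‖ₑ ^ 2 = ENNReal.ofReal (‖z‖ ^ 2) := fun z => by
    rw [ENNReal.ofReal_pow (norm_nonneg _), ofReal_norm]
  have hmem : MemLp (fun x => splineZak (m + 1) x (τ : UnitAddCircle)) 2
      (volume.restrict (Set.Ioc (0 : ℝ) 1)) :=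
    MemLp.of_bound ((measurable_splineZak m).comp
      (measurable_id.prodMk measurable_const)).aestronglyMeasurable _
      (Filter.Eventually.of_forall fun x => norm_splineZak_le m x _)
  rw [intervalIntegral.integral_of_le zero_le_one] at h
  simp only [e]
  rw [← ofReal_integral_eq_lintegral_ofReal (integrable_norm_sq hmem)
    (Filter.Eventually.of_forall fun x => sq_nonneg _), h]
  have hb := cscPoly_eval_bounds m (Real.abs_cos_le_one (Real.pi * τ))
  exact ⟨ENNReal.ofReal_le_ofReal hb.1, by simpa using hb.2⟩

/-- The Riesz bounds of the integer translates of the B-spline `Q_{m+1}`. -/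
theorem spline_norm_bounds (m : ℕ) {c : ℤ → ℂ} (hc : Summable fun k => ‖c k‖ ^ 2)
    {f : ℝ → ℂ} (hfm : Measurable f)
    (hf : ∀ x : ℝ, HasSum (fun k : ℤ => c k * (bspline (m + 1) (x - k) : ℂ)) (f x)) :
    MemLp f 2 volume ∧ (cscPoly (2 * m)).eval 0 * ∑' k, ‖c k‖ ^ 2 ≤ ∫ x, ‖f x‖ ^ 2 ∧
      ∫ x, ‖f x‖ ^ 2 ≤ ∑' k, ‖c k‖ ^ 2 := by
  obtain ⟨F, hFm, hF, hFc⟩ := exists_memLp_fourierCoeff_eq hc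
  have h := lintegral_spline_enorm_sq m hFm hF hFc hfm hf
  have hb := ae_lintegral_splineZak_bounds m
  have e : ∀ z : ℂ, ‖z‖ₑ ^ 2 = ENNReal.ofReal (‖z‖ ^ 2) := fun z => by
    rw [ENNReal.ofReal_pow (norm_nonneg _), ofReal_norm]
  have hnorm : ∫⁻ t, ‖F t‖ₑ ^ 2 ∂haarAddCircle = ENNReal.ofReal (∑' k, ‖c k‖ ^ 2) := by
    rw [← tsum_enorm_sq_fourierCoeff hF, ENNReal.ofReal_tsum_of_nonneg (fun k => sq_nonneg _) hc]
    simp only [e, hFc]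
  have hup : ∫⁻ x, ‖f x‖ₑ ^ 2 ≤ ENNReal.ofReal (∑' k, ‖c k‖ ^ 2) := by
    rw [h, ← hnorm]
    refine lintegral_mono_ae ?_
    filter_upwards [hb] with t ht
    exact mul_le_of_le_one_right zero_le ht.2
  have hlow : ENNReal.ofReal ((cscPoly (2 * m)).eval 0 * ∑' k, ‖c k‖ ^ 2) ≤
      ∫⁻ x, ‖f x‖ₑ ^ 2 := by
    rw [h, ENNReal.ofReal_mul (cscPoly_eval_zero_pos m).le, ← hnorm, mul_comm,
      ← lintegral_mul_const _ (hFm.measurable.enorm.pow_const 2)]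
    refine lintegral_mono_ae ?_
    filter_upwards [hb] with t ht
    exact mul_le_mul_right ht.1 _
  have hmem : MemLp f 2 volume := by
    refine ⟨hfm.aestronglyMeasurable, ?_⟩
    rw [eLpNorm_lt_top_iff_lintegral_rpow_enorm_lt_top two_ne_zero ENNReal.ofNat_ne_top]
    simpa using hup.trans_lt ENNReal.ofReal_lt_top
  simp only [e] at hup hlow
  rw [← ofReal_integral_eq_lintegral_ofReal (integrable_norm_sq hmem)
    (Filter.Eventually.of_forall fun x => sq_nonneg _)] at hup hlow
  refine ⟨hmem, ?_, ?_⟩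
  · exact (ENNReal.ofReal_le_ofReal_iff (integral_nonneg fun x => sq_nonneg _)).1 hlow
  · exact (ENNReal.ofReal_le_ofReal_iff (tsum_nonneg fun k => sq_nonneg _)).1 hup

end SplineSampling

/-! ### Gram eigenvalues and convolution systems -/

namespace SplineSampling

open MeasureTheory AddCircle

section Gram

variable {n : ℕ}

theorem star_dotProduct_self_eq (v : Fin n → ℂ) :
    star v ⬝ᵥ v = ((∑ i, ‖v i‖ ^ 2 : ℝ) : ℂ) := by
  simp only [dotProduct, Pi.star_apply, RCLike.star_def, Complex.conj_mul']
  push_cast; rfl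

theorem sum_norm_sq_mulVec_eq (A : Matrix (Fin n) (Fin n) ℂ) (v : Fin n → ℂ) :
    ((∑ i, ‖(A *ᵥ v) i‖ ^ 2 : ℝ) : ℂ) = star v ⬝ᵥ ((Aᴴ * A) *ᵥ v) := by
  rw [← star_dotProduct_self_eq, Matrix.star_mulVec, ← Matrix.dotProduct_mulVec,
    Matrix.mulVec_mulVec]

/-- Spectral theorem: `w = U* v` for a unitary `U` diagonalizing `A* A`. -/
theorem exists_sum_norm_sq_mulVec_eq_eigenvalues (A : Matrix (Fin n) (Fin n) ℂ) (v : Fin n → ℂ) :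
    ∃ w : Fin n → ℂ, ∑ i, ‖w i‖ ^ 2 = ∑ i, ‖v i‖ ^ 2 ∧ ∑ i, ‖(A *ᵥ v) i‖ ^ 2 =
      ∑ i, (Matrix.isHermitian_conjTranspose_mul_self A).eigenvalues i * ‖w i‖ ^ 2 := by
  set hA := Matrix.isHermitian_conjTranspose_mul_self A
  set U : Matrix (Fin n) (Fin n) ℂ := hA.eigenvectorUnitary.1
  have hUU : U * star U = 1 := Unitary.mul_star_self_of_mem hA.eigenvectorUnitary.2
  have hs : Aᴴ * A = U * Matrix.diagonal (fun i => (hA.eigenvalues i : ℂ)) * star U := by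
    have := hA.spectral_theorem
    rw [Unitary.conjStarAlgAut_apply] at this
    exact this
  obtain ⟨lam, hlam⟩ : ∃ lam, lam = hA.eigenvalues := ⟨_, rfl⟩
  rw [← hlam] at hs ⊢
  clear_value U
  have hw : star (star U *ᵥ v) = star v ᵥ* U := by
    rw [Matrix.star_mulVec, Matrix.star_eq_conjTranspose, Matrix.conjTranspose_conjTranspose]
  refine ⟨star U *ᵥ v, ?_, ?_⟩
  · apply Complex.ofReal_injective
    rw [← star_dotProduct_self_eq, ← star_dotProduct_self_eq, hw, ← Matrix.dotProduct_mulVec,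
      Matrix.mulVec_mulVec, hUU, Matrix.one_mulVec]
  · apply Complex.ofReal_injective
    rw [sum_norm_sq_mulVec_eq, hs, ← Matrix.mulVec_mulVec, ← Matrix.mulVec_mulVec,
      Matrix.dotProduct_mulVec, ← hw]
    generalize star U *ᵥ v = w
    simp only [dotProduct, Pi.star_apply, RCLike.star_def, Matrix.mulVec_diagonal]
    push_cast
    refine Finset.sum_congr rfl fun i _ => ?_
    rw [← Complex.conj_mul']; ring

theorem minEigenvalueGram_mul_le (A : Matrix (Fin n) (Fin n) ℂ) (v : Fin n → ℂ) :
    minEigenvalueGram A * ∑ i, ‖v i‖ ^ 2 ≤ ∑ i, ‖(A *ᵥ v) i‖ ^ 2 := by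
  obtain ⟨w, hw, hv⟩ := exists_sum_norm_sq_mulVec_eq_eigenvalues A v
  rw [← hw, hv, Finset.mul_sum]
  exact Finset.sum_le_sum fun i _ => mul_le_mul_of_nonneg_right
    (ciInf_le (Set.finite_range _).bddBelow i) (sq_nonneg _)

theorem le_maxEigenvalueGram_mul (A : Matrix (Fin n) (Fin n) ℂ) (v : Fin n → ℂ) :
    ∑ i, ‖(A *ᵥ v) i‖ ^ 2 ≤ maxEigenvalueGram A * ∑ i, ‖v i‖ ^ 2 := by
  obtain ⟨w, hw, hv⟩ := exists_sum_norm_sq_mulVec_eq_eigenvalues A v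
  rw [← hw, hv, Finset.mul_sum]
  exact Finset.sum_le_sum fun i _ => mul_le_mul_of_nonneg_right
    (le_ciSup (Set.finite_range _).bddAbove i) (sq_nonneg _)

/-- Each eigenvalue is a value of `‖Av‖²` on the unit sphere, so norm estimates for `A` bound the
eigenvalues. -/
theorem exists_eigenvector_gram (A : Matrix (Fin n) (Fin n) ℂ) (j : Fin n) :
    ∃ v : Fin n → ℂ, ∑ i, ‖v i‖ ^ 2 = 1 ∧ ∑ i, ‖(A *ᵥ v) i‖ ^ 2 =
      (Matrix.isHermitian_conjTranspose_mul_self A).eigenvalues j := by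
  set hA := Matrix.isHermitian_conjTranspose_mul_self A
  have h1 : ∑ i, ‖hA.eigenvectorBasis j i‖ ^ 2 = 1 := by
    rw [← EuclideanSpace.norm_sq_eq, hA.eigenvectorBasis.orthonormal.1, one_pow]
  refine ⟨⇑(hA.eigenvectorBasis j), h1, ?_⟩
  apply Complex.ofReal_injective
  rw [sum_norm_sq_mulVec_eq, hA.mulVec_eigenvectorBasis, dotProduct_smul,
    star_dotProduct_self_eq, h1]
  simp

theorem sum_norm_sq_mulVec_le {N : Matrix (Fin n) (Fin n) ℂ} {K : ℝ} (hN : ∀ i j, ‖N i j‖ ≤ K)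
    (v : Fin n → ℂ) :
    ∑ i, ‖(N *ᵥ v) i‖ ^ 2 ≤ (n * K) ^ 2 * ∑ i, ‖v i‖ ^ 2 := by
  have h : ∀ i, ‖(N *ᵥ v) i‖ ^ 2 ≤ K ^ 2 * (n * ∑ i, ‖v i‖ ^ 2) := by
    intro i
    have h1 : ‖(N *ᵥ v) i‖ ≤ K * ∑ j, ‖v j‖ := by
      rw [Finset.mul_sum]
      refine (norm_sum_le Finset.univ fun j => N i j * v j).trans (Finset.sum_le_sum fun j _ => ?_)
      rw [norm_mul]
      exact mul_le_mul_of_nonneg_right (hN i j) (norm_nonneg _)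
    have h2 : (∑ j, ‖v j‖) ^ 2 ≤ n * ∑ j, ‖v j‖ ^ 2 := by
      simpa using sq_sum_le_card_mul_sum_sq (s := Finset.univ) (f := fun j => ‖v j‖)
    calc _ ≤ (K * ∑ j, ‖v j‖) ^ 2 := pow_le_pow_left₀ (norm_nonneg _) h1 2
      _ = K ^ 2 * (∑ j, ‖v j‖) ^ 2 := by ring
      _ ≤ _ := mul_le_mul_of_nonneg_left h2 (sq_nonneg _)
  calc _ ≤ ∑ _i : Fin n, K ^ 2 * (n * ∑ i, ‖v i‖ ^ 2) := Finset.sum_le_sum fun i _ => h i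
    _ = _ := by simp; ring

theorem minEigenvalueGram_nonneg (A : Matrix (Fin n) (Fin n) ℂ) : 0 ≤ minEigenvalueGram A :=
  Real.iInf_nonneg fun j => by
    obtain ⟨v, -, hv⟩ := exists_eigenvector_gram A j
    rw [← hv]; positivity

theorem maxEigenvalueGram_nonneg (A : Matrix (Fin n) (Fin n) ℂ) : 0 ≤ maxEigenvalueGram A :=
  Real.iSup_nonneg fun j => by
    obtain ⟨v, -, hv⟩ := exists_eigenvector_gram A j
    rw [← hv]; positivity

theorem maxEigenvalueGram_le {A : Matrix (Fin n) (Fin n) ℂ} {K : ℝ} (hA : ∀ i j, ‖A i j‖ ≤ K) :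
    maxEigenvalueGram A ≤ (n * K) ^ 2 :=
  Real.iSup_le (fun j => by
    obtain ⟨v, h1, hv⟩ := exists_eigenvector_gram A j
    rw [← hv]
    simpa [h1] using sum_norm_sq_mulVec_le hA v) (sq_nonneg _)

/-- The norm bound for `A⁻¹` is applied to `Av` with `v` a unit eigenvector. The constant is crude;
it serves to make the infimum over `t` positive. -/
theorem le_minEigenvalueGram [NeZero n] {A : Matrix (Fin n) (Fin n) ℂ} (hdet : A.det ≠ 0) {K : ℝ}
    (hA : ∀ i j, ‖A⁻¹ i j‖ ≤ K) (hK : 0 < K) : ((n * K) ^ 2)⁻¹ ≤ minEigenvalueGram A := by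
  refine le_ciInf fun j => ?_
  obtain ⟨v, h1, hv⟩ := exists_eigenvector_gram A j
  have h := sum_norm_sq_mulVec_le hA (A *ᵥ v)
  rw [Matrix.mulVec_mulVec, Matrix.nonsing_inv_mul _ (isUnit_iff_ne_zero.2 hdet),
    Matrix.one_mulVec, h1, hv] at h
  have hn : (0 : ℝ) < n := by exact_mod_cast Nat.pos_of_ne_zero (NeZero.ne n)
  rw [inv_le_iff_one_le_mul₀' (by positivity)]
  exact h

end Gram

section System

variable {n : ℕ} (s : Finset ℤ) (q : Fin n → Fin n → ℤ → ℂ)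

/-- The matrix of trigonometric polynomials with coefficients `q i j k`, `k ∈ s`. -/
noncomputable def trigMatrix (t : UnitAddCircle) : Matrix (Fin n) (Fin n) ℂ :=
  Matrix.of fun i j => ∑ k ∈ s, q i j k * fourier k t

theorem continuous_trigMatrix : Continuous (trigMatrix s q) :=
  continuous_matrix fun _ _ => continuous_finsetSum _ fun _ _ =>
    continuous_const.mul (map_continuous _)

/-- Cramer's rule: the inverse is the adjugate divided by a nonvanishing continuous determinant. -/
theorem continuous_trigMatrix_inv (hdet : ∀ t, (trigMatrix s q t).det ≠ 0) :
    Continuous fun t => (trigMatrix s q t)⁻¹ := by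
  have hM := continuous_trigMatrix s q
  have : (fun t => (trigMatrix s q t)⁻¹) =
      fun t => (trigMatrix s q t).det⁻¹ • (trigMatrix s q t).adjugate := by
    ext t : 1
    rw [Matrix.inv_def, Ring.inverse_eq_inv']
  rw [this]
  exact (hM.matrix_det.inv₀ hdet).smul hM.matrix_adjugate

theorem exists_bound_of_continuous_matrix {M : UnitAddCircle → Matrix (Fin n) (Fin n) ℂ}
    (hM : Continuous M) : ∃ K, 0 < K ∧ ∀ t i j, ‖M t i j‖ ≤ K := by
  have h : ∀ p : Fin n × Fin n, ∃ K, ∀ t, ‖M t p.1 p.2‖ ≤ K := fun p => by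
    obtain ⟨K, hK⟩ := isCompact_univ.exists_bound_of_continuousOn
      (hM.matrix_elem p.1 p.2).continuousOn
    exact ⟨K, fun t => hK t trivial⟩
  choose K hK using h
  refine ⟨1 + ∑ p, |K p|, by positivity, fun t i j => ?_⟩
  have := Finset.single_le_sum (f := fun p => |K p|) (fun p _ => abs_nonneg _)
    (Finset.mem_univ (i, j))
  have h2 := hK (i, j) t
  have h3 := le_abs_self (K (i, j))
  simp only at this h2
  linarith

/-- The convolution system with coefficients `q`. -/
noncomputable def trigConv (c : Fin n → ℤ → ℂ) (i : Fin n) (l : ℤ) : ℂ :=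
  ∑ j, ∑ k ∈ s, q i j k * c j (l - k)

theorem memLp_trigMatrix_mulVec {C : Fin n → UnitAddCircle → ℂ}
    (hC : ∀ j, MemLp (C j) 2 haarAddCircle) {M : UnitAddCircle → Matrix (Fin n) (Fin n) ℂ}
    (hM : Continuous M) (i : Fin n) :
    MemLp (fun t => (M t *ᵥ fun j => C j t) i) 2 haarAddCircle :=
  memLp_finsetSum (f := fun j t => M t i j * C j t) Finset.univ
    fun j _ => memLp_continuous_mul (hM.matrix_elem i j) (hC j)

theorem fourierCoeff_trigMatrix_mulVec {C : Fin n → UnitAddCircle → ℂ}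
    (hC : ∀ j, MemLp (C j) 2 haarAddCircle) (i : Fin n) (l : ℤ) :
    fourierCoeff (fun t => (trigMatrix s q t *ᵥ fun j => C j t) i) l =
      trigConv s q (fun j => fourierCoeff (C j)) i l := by
  have h : (fun t => (trigMatrix s q t *ᵥ fun j => C j t) i) =
      ∑ j, fun t => (∑ k ∈ s, q i j k * fourier k t) * C j t := by
    ext t
    simp [Matrix.mulVec, dotProduct, trigMatrix]
  rw [h, fourierCoeff.sum, Finset.sum_apply]
  · exact Finset.sum_congr rfl fun j _ => fourierCoeff_trigPoly_mul s _ (hC j) l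
  · intro j _
    exact (memLp_continuous_mul ((continuous_trigMatrix s q).matrix_elem i j) (hC j)).integrable
      one_le_two

/-- Both energies are integrals over the circle by Parseval, so the pointwise matrix inequalities
are integrated in `t`. -/
theorem trigConv_bounds {A B : ℝ}
    (hA : ∀ t v, A * ∑ j, ‖v j‖ ^ 2 ≤ ∑ i, ‖(trigMatrix s q t *ᵥ v) i‖ ^ 2)
    (hB : ∀ t v, ∑ i, ‖(trigMatrix s q t *ᵥ v) i‖ ^ 2 ≤ B * ∑ j, ‖v j‖ ^ 2)
    {c : Fin n → ℤ → ℂ} (hc : ∀ j, Summable fun l => ‖c j l‖ ^ 2) :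
    (∀ i, Summable fun l => ‖trigConv s q c i l‖ ^ 2) ∧
      A * ∑ j, ∑' l, ‖c j l‖ ^ 2 ≤ ∑ i, ∑' l, ‖trigConv s q c i l‖ ^ 2 ∧
      ∑ i, ∑' l, ‖trigConv s q c i l‖ ^ 2 ≤ B * ∑ j, ∑' l, ‖c j l‖ ^ 2 := by
  choose C _ hC hCc using fun j => exists_memLp_fourierCoeff_eq (hc j)
  have hc' : c = fun j => fourierCoeff (C j) := funext fun j => (funext (hCc j)).symm
  have hD := memLp_trigMatrix_mulVec hC (continuous_trigMatrix s q)
  have hDs := fun i => hasSum_sq_fourierCoeff_of_memLp (hD i)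
  simp only [fourierCoeff_trigMatrix_mulVec s q hC, ← hc'] at hDs
  have hCs := fun j => hasSum_sq_fourierCoeff_of_memLp (hC j)
  simp only [hCc] at hCs
  have hCi := fun j => integrable_norm_sq (hC j)
  have hDi := fun i => integrable_norm_sq (hD i)
  simp only [fun i => (hDs i).tsum_eq, fun j => (hCs j).tsum_eq]
  rw [← integral_finsetSum _ fun i _ => hDi i, ← integral_finsetSum _ fun i _ => hCi i,
    ← integral_const_mul, ← integral_const_mul]
  refine ⟨fun i => (hDs i).summable, ?_, ?_⟩
  · exact integral_mono ((integrable_finsetSum _ fun j _ => hCi j).const_mul _)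
      (integrable_finsetSum _ fun i _ => hDi i) fun t => hA t _
  · exact integral_mono (integrable_finsetSum _ fun i _ => hDi i)
      ((integrable_finsetSum _ fun j _ => hCi j).const_mul _) fun t => hB t _

/-- The solution is the sequence of Fourier coefficients of `Ψ⁻¹ D`, where `D` has coefficients `d`;
it is in `L²` because `Ψ⁻¹` is continuous, hence bounded. -/
theorem exists_trigConv_eq (hdet : ∀ t, (trigMatrix s q t).det ≠ 0)
    {d : Fin n → ℤ → ℂ} (hd : ∀ j, Summable fun l => ‖d j l‖ ^ 2) :
    ∃ c : Fin n → ℤ → ℂ, (∀ j, Summable fun l => ‖c j l‖ ^ 2) ∧ trigConv s q c = d := by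
  choose D _ hD hDd using fun j => exists_memLp_fourierCoeff_eq (hd j)
  set C : Fin n → UnitAddCircle → ℂ := fun i t => ((trigMatrix s q t)⁻¹ *ᵥ fun j => D j t) i
  have hC : ∀ i, MemLp (C i) 2 haarAddCircle :=
    memLp_trigMatrix_mulVec hD (continuous_trigMatrix_inv s q hdet)
  refine ⟨fun j => fourierCoeff (C j), fun j => (hasSum_sq_fourierCoeff_of_memLp (hC j)).summable,
    ?_⟩
  ext i l
  rw [← fourierCoeff_trigMatrix_mulVec s q hC, ← hDd]
  congr 1
  ext t
  change (trigMatrix s q t *ᵥ ((trigMatrix s q t)⁻¹ *ᵥ fun j => D j t)) i = _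
  rw [Matrix.mulVec_mulVec, Matrix.mul_nonsing_inv _ (isUnit_iff_ne_zero.2 (hdet t)),
    Matrix.one_mulVec]

end System

end SplineSampling

/-! ### Derivative samples as a convolution system -/

namespace SplineSampling

open MeasureTheory AddCircle

theorem iteratedDeriv_complex_ofReal {n : ℕ} {g : ℝ → ℝ} (hg : ContDiff ℝ n g) {i : ℕ}
    (hi : i ≤ n) : iteratedDeriv i (fun x => (g x : ℂ)) = fun x => ((iteratedDeriv i g x : ℝ) : ℂ) := by
  induction i with
  | zero => simp
  | succ i ih =>
    rw [iteratedDeriv_succ, ih (by omega)]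
    ext x
    have h : DifferentiableAt ℝ (iteratedDeriv i g) x :=
      hg.differentiable_iteratedDeriv i (by exact_mod_cast hi) x
    rw [h.hasDerivAt.ofReal_comp.deriv, iteratedDeriv_succ]

theorem iteratedDeriv_bspline_eq_zero (m i : ℕ) {x : ℝ} (hx : x ∉ Set.Icc (0 : ℝ) (m + 1)) :
    iteratedDeriv i (bspline (m + 1)) x = 0 := by
  have h : bspline (m + 1) =ᶠ[nhds x] fun _ => 0 := by
    filter_upwards [isClosed_Icc.isOpen_compl.mem_nhds hx] with y hy
    exact (bspline_basic m).2.2 y hy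
  rw [h.iteratedDeriv_eq, iteratedDeriv_fun_const_zero]

section Series

variable {m : ℕ} {c : ℤ → ℂ} {f : ℝ → ℂ}

/-- One finite index set serves a whole neighbourhood of `x`, so the series is locally a finite sum
and may be differentiated termwise. -/
theorem sub_int_notMem_Icc {x y : ℝ} (hy : y ∈ Set.Ioo (x - 1) (x + 1)) {k : ℤ}
    (hk : k ∉ Finset.Icc (⌊x⌋ - (m + 3)) (⌊x⌋ + 2)) :
    y - k ∉ Set.Icc (0 : ℝ) ((m + 1 : ℕ) + 1) := by
  intro h
  apply hk
  have h1 := Int.floor_le x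
  have h2 := Int.lt_floor_add_one x
  have h3 := h.1
  have h4 := h.2
  push_cast at h4
  rw [Finset.mem_Icc]
  constructor
  · have : ((⌊x⌋ - (m + 3) : ℤ) : ℝ) ≤ k := by push_cast; linarith [hy.1]
    exact_mod_cast this
  · have : (k : ℝ) ≤ ((⌊x⌋ + 2 : ℤ) : ℝ) := by push_cast; linarith [hy.2]
    exact_mod_cast this

theorem spline_eventuallyEq
    (hf : ∀ x : ℝ, HasSum (fun k : ℤ => c k * (bspline (m + 2) (x - k) : ℂ)) (f x)) (x : ℝ) :
    f =ᶠ[nhds x] fun y => ∑ k ∈ Finset.Icc (⌊x⌋ - (m + 3)) (⌊x⌋ + 2),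
      c k * (bspline (m + 2) (y - k) : ℂ) := by
  filter_upwards [Ioo_mem_nhds (sub_one_lt x) (lt_add_one x)] with y hy
  refine (hf y).unique (hasSum_sum_of_ne_finset_zero fun k hk => ?_)
  rw [(bspline_basic (m + 1)).2.2 _ (sub_int_notMem_Icc hy hk)]
  simp

theorem contDiff_spline_term (k : ℤ) :
    ContDiff ℝ m fun y : ℝ => c k * (bspline (m + 2) (y - k) : ℂ) :=
  contDiff_const.mul (Complex.ofRealCLM.contDiff.comp
    ((contDiff_bspline m).comp (contDiff_id.sub contDiff_const)))

theorem contDiff_spline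
    (hf : ∀ x : ℝ, HasSum (fun k : ℤ => c k * (bspline (m + 2) (x - k) : ℂ)) (f x)) :
    ContDiff ℝ m f :=
  contDiff_iff_contDiffAt.2 fun x =>
    (ContDiffAt.sum fun k _ => (contDiff_spline_term k).contDiffAt).congr_of_eventuallyEq
      (spline_eventuallyEq hf x)

theorem hasSum_iteratedDeriv_spline
    (hf : ∀ x : ℝ, HasSum (fun k : ℤ => c k * (bspline (m + 2) (x - k) : ℂ)) (f x))
    {i : ℕ} (hi : i ≤ m) (x : ℝ) :
    HasSum (fun k : ℤ => c k * ((iteratedDeriv i (bspline (m + 2)) (x - k) : ℝ) : ℂ))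
      (iteratedDeriv i f x) := by
  have hi' : (i : WithTop ℕ∞) ≤ (m : WithTop ℕ∞) := by exact_mod_cast hi
  rw [(spline_eventuallyEq hf x).iteratedDeriv_eq,
    iteratedDeriv_fun_sum fun k _ => ((contDiff_spline_term k).of_le hi').contDiffAt]
  have h : ∀ k : ℤ, iteratedDeriv i (fun y : ℝ => c k * (bspline (m + 2) (y - k) : ℂ)) x =
      c k * ((iteratedDeriv i (bspline (m + 2)) (x - k) : ℝ) : ℂ) := by
    intro k
    rw [iteratedDeriv_const_mul_field,
      iteratedDeriv_comp_sub_const (f := fun y : ℝ => (bspline (m + 2) y : ℂ)),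
      iteratedDeriv_complex_ofReal (contDiff_bspline m) hi]
  rw [Finset.sum_congr rfl fun k _ => h k]
  refine hasSum_sum_of_ne_finset_zero fun k hk => ?_
  rw [iteratedDeriv_bspline_eq_zero (m + 1) i
    (sub_int_notMem_Icc ⟨sub_one_lt x, lt_add_one x⟩ hk)]
  simp

end Series

/-- The coefficients of the matrix symbol of the B-spline `Q_m`. -/
noncomputable def symbolCoeff (m : ℕ) (a : ℝ) (ρ : ℕ) (i j : Fin ρ) (k : ℤ) : ℂ :=
  (iteratedDeriv (i : ℕ) (bspline m) (a + (ρ : ℝ) * (k : ℝ) - ((j : ℕ) : ℝ)) : ℝ)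

theorem symbolCoeff_eq_zero (m : ℕ) {a : ℝ} (ha : a = 0 ∨ a = 1 / 2) {ρ : ℕ} (i j : Fin ρ)
    {k : ℤ} (hk : k ∉ Finset.Icc (0 : ℤ) (m + 1 + ρ : ℕ)) : symbolCoeff (m + 1) a ρ i j k = 0 := by
  rw [symbolCoeff, iteratedDeriv_bspline_eq_zero, Complex.ofReal_zero]
  intro h
  apply hk
  have ha0 : 0 ≤ a := by rcases ha with rfl | rfl <;> norm_num
  have ha1 : a < 1 := by rcases ha with rfl | rfl <;> norm_num
  have hj : ((j : ℕ) : ℝ) + 1 ≤ ρ := by exact_mod_cast j.2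
  have hj0 : (0 : ℝ) ≤ ((j : ℕ) : ℝ) := by positivity
  have hρ : (1 : ℝ) ≤ ρ := by linarith
  rw [Finset.mem_Icc]
  have hk0 : (0 : ℤ) ≤ k := by
    by_contra! hneg
    have hk' : (k : ℝ) ≤ -1 := by exact_mod_cast Int.le_sub_one_of_lt hneg
    have := mul_le_mul_of_nonneg_left hk' (by linarith : (0 : ℝ) ≤ ρ)
    linarith [h.1]
  refine ⟨hk0, ?_⟩
  have hk0' : (0 : ℝ) ≤ k := by exact_mod_cast hk0
  have := mul_le_mul_of_nonneg_right hρ hk0'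
  have : (k : ℝ) ≤ ((m + 1 + ρ : ℕ) : ℝ) := by push_cast; linarith [h.2]
  exact_mod_cast this

theorem symbol_eq_trigMatrix (m : ℕ) {a : ℝ} (ha : a = 0 ∨ a = 1 / 2) (ρ : ℕ) (τ : ℝ) :
    symbol (bspline (m + 1)) a ρ τ = trigMatrix (Finset.Icc (0 : ℤ) (m + 1 + ρ : ℕ))
      (symbolCoeff (m + 1) a ρ) (τ : UnitAddCircle) := by
  ext i j
  rw [symbol, trigMatrix, Matrix.of_apply, Matrix.of_apply]
  refine (tsum_eq_sum fun k hk => ?_).trans (Finset.sum_congr rfl fun k _ => ?_)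
  · exact mul_eq_zero_of_left (symbolCoeff_eq_zero m ha i j hk) _
  · rw [fourier_coe_apply]
    simp [symbolCoeff]

theorem exists_coe_eq_of_unitAddCircle (t : UnitAddCircle) :
    ∃ τ ∈ Set.Icc (0 : ℝ) 1, (τ : UnitAddCircle) = t := by
  have := (AddCircle.equivIco (1 : ℝ) 0 t).2
  refine ⟨AddCircle.equivIco 1 0 t, ⟨this.1, by simpa using this.2.le⟩, ?_⟩
  exact (AddCircle.equivIco (1 : ℝ) 0).symm_apply_apply t

section Samples

variable {ρ : ℕ} [NeZero ρ]

/-- Reindexing of the differentiated series by `k ↦ ρ(l - n) + j`. The bound on `ρ` keeps the orders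
`i ≤ ρ - 1` within the smoothness `C^m` of `Q_{m+2}`. -/
theorem iteratedDeriv_spline_eq_trigConv {m : ℕ} {c : ℤ → ℂ} {f : ℝ → ℂ}
    (hf : ∀ x : ℝ, HasSum (fun k : ℤ => c k * (bspline (m + 2) (x - k) : ℂ)) (f x))
    (hρ : ρ ≤ m + 1) {a : ℝ} (ha : a = 0 ∨ a = 1 / 2) (i : Fin ρ) (l : ℤ) :
    iteratedDeriv (i : ℕ) f (a + (ρ : ℝ) * (l : ℝ)) =
      trigConv (Finset.Icc (0 : ℤ) (m + 1 + 1 + ρ : ℕ)) (symbolCoeff (m + 2) a ρ)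
        (fun j n => c ((Int.divModEquiv ρ).symm (n, j))) i l := by
  have h := hasSum_iteratedDeriv_spline hf (i := i) (by omega) (a + (ρ : ℝ) * (l : ℝ))
  rw [← ((Equiv.prodCongr (Equiv.subLeft l) (Equiv.refl (Fin ρ))).trans
    (Int.divModEquiv ρ).symm).hasSum_iff] at h
  refine h.unique ?_
  have e : ∀ p : ℤ × Fin ρ, ((fun k : ℤ => c k *
      ((iteratedDeriv (i : ℕ) (bspline (m + 2)) (a + (ρ : ℝ) * (l : ℝ) - k) : ℝ) : ℂ)) ∘
      ((Equiv.prodCongr (Equiv.subLeft l) (Equiv.refl (Fin ρ))).trans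
        (Int.divModEquiv ρ).symm)) p =
      symbolCoeff (m + 2) a ρ i p.2 p.1 * c ((Int.divModEquiv ρ).symm (l - p.1, p.2)) := by
    rintro ⟨n, j⟩
    simp only [Function.comp_apply, Equiv.trans_apply, Equiv.prodCongr_apply, Prod.map,
      Equiv.subLeft_apply, Equiv.refl_apply, symbolCoeff, Int.divModEquiv_symm_apply]
    rw [mul_comm]
    congr 3
    push_cast
    ring
  rw [funext e, trigConv, Finset.sum_comm, ← Finset.sum_product'
    (f := fun k j => symbolCoeff (m + 2) a ρ i j k * c ((Int.divModEquiv ρ).symm (l - k, j)))]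
  refine hasSum_sum_of_ne_finset_zero fun p hp => ?_
  rw [symbolCoeff_eq_zero (m + 1) ha i p.2, zero_mul]
  intro hc
  exact hp (Finset.mem_product.2 ⟨hc, Finset.mem_univ _⟩)

theorem summable_divModEquiv {c : ℤ → ℂ} (hc : Summable fun k => ‖c k‖ ^ 2) (j : Fin ρ) :
    Summable fun n => ‖c ((Int.divModEquiv ρ).symm (n, j))‖ ^ 2 :=
  hc.comp_injective (i := fun n => (Int.divModEquiv ρ).symm (n, j)) fun a b hab => by
    simpa using (Int.divModEquiv ρ).symm.injective hab

theorem sum_tsum_divModEquiv {c : ℤ → ℂ} (hc : Summable fun k => ‖c k‖ ^ 2) :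
    ∑ j : Fin ρ, ∑' n, ‖c ((Int.divModEquiv ρ).symm (n, j))‖ ^ 2 = ∑' k, ‖c k‖ ^ 2 := by
  let e := (Equiv.prodComm (Fin ρ) ℤ).trans (Int.divModEquiv ρ).symm
  have hs : Summable fun p : Fin ρ × ℤ => ‖c ((Int.divModEquiv ρ).symm (p.2, p.1))‖ ^ 2 :=
    (e.summable_iff (f := fun k => ‖c k‖ ^ 2)).2 hc
  have h := hs.tsum_prod' fun j => summable_divModEquiv hc j
  rw [tsum_fintype (L := SummationFilter.unconditional _)
    (fun j : Fin ρ => ∑' n, ‖c ((Int.divModEquiv ρ).symm (n, j))‖ ^ 2)] at h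
  exact h.symm.trans (e.tsum_eq fun k => ‖c k‖ ^ 2)

theorem summable_of_divModEquiv {c : Fin ρ → ℤ → ℂ} (hc : ∀ j, Summable fun n => ‖c j n‖ ^ 2) :
    Summable fun k => ‖c (Int.divModEquiv ρ k).2 (Int.divModEquiv ρ k).1‖ ^ 2 := by
  let e := (Int.divModEquiv ρ).trans (Equiv.prodComm ℤ (Fin ρ))
  have h : Summable fun p : Fin ρ × ℤ => ‖c p.1 p.2‖ ^ 2 :=
    (summable_prod_of_nonneg fun p => sq_nonneg _).2 ⟨hc, (hasSum_fintype _).summable⟩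
  exact (e.summable_iff (f := fun p : Fin ρ × ℤ => ‖c p.1 p.2‖ ^ 2)).2 h

end Samples

end SplineSampling

/-! ### Assembly of the theorem -/

open SplineSampling in
theorem spline_completeInterpolation_and_bounds (m r : ℕ) (hm : r + 1 ≤ m + 1) (a : ℝ) (ha : a = 0 ∨ a = 1 / 2)
    (hdet : ∀ t ∈ Set.Icc (0 : ℝ) 1, (symbol (bspline (m + 2)) a (r + 1) t).det ≠ 0) :
    IsCompleteInterpolationSet (bspline (m + 2)) r
        (fun l : ℤ => a + ((r + 1 : ℕ) : ℝ) * (l : ℝ)) ∧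
      0 < lowerConst (bspline (m + 2)) a (r + 1) ∧
      ∀ f ∈ shiftInvariantSpace (bspline (m + 2)),
        ContDiff ℝ (r : WithTop ℕ∞) f ∧
        (∀ i ∈ Finset.range (r + 1), Summable (fun l : ℤ =>
          ‖iteratedDeriv i f (a + ((r + 1 : ℕ) : ℝ) * (l : ℝ))‖ ^ 2)) ∧
        lowerConst (bspline (m + 2)) a (r + 1) * (∫ x : ℝ, ‖f x‖ ^ 2) ≤
          ∑ i ∈ Finset.range (r + 1), ∑' l : ℤ,
            ‖iteratedDeriv i f (a + ((r + 1 : ℕ) : ℝ) * (l : ℝ))‖ ^ 2 ∧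
        ∑ i ∈ Finset.range (r + 1), ∑' l : ℤ,
            ‖iteratedDeriv i f (a + ((r + 1 : ℕ) : ℝ) * (l : ℝ))‖ ^ 2 ≤
          upperConst (bspline (m + 2)) a (r + 1) *
            (Real.pi ^ (2 * (m + 2) - 1) /
              (2 ^ (2 * (m + 2) - 1) * favardConst (2 * (m + 2) - 1))) *
            (∫ x : ℝ, ‖f x‖ ^ 2) := by
  set ρ := r + 1 with hρdef
  set s := Finset.Icc (0 : ℤ) (m + 1 + 1 + ρ : ℕ)
  set q := symbolCoeff (m + 2) a ρ
  have hsym : ∀ τ : ℝ, symbol (bspline (m + 2)) a ρ τ = trigMatrix s q (τ : UnitAddCircle) :=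
    symbol_eq_trigMatrix (m + 1) ha ρ
  have hdet' : ∀ t, (trigMatrix s q t).det ≠ 0 := by
    intro t
    obtain ⟨τ, hτ, rfl⟩ := exists_coe_eq_of_unitAddCircle t
    rw [← hsym]
    exact hdet τ hτ
  obtain ⟨K, hK0, hK⟩ := exists_bound_of_continuous_matrix (continuous_trigMatrix s q)
  obtain ⟨L, hL0, hL⟩ := exists_bound_of_continuous_matrix (continuous_trigMatrix_inv s q hdet')
  have hbelow : BddBelow (Set.range fun t : Set.Icc (0 : ℝ) 1 =>
      minEigenvalueGram (symbol (bspline (m + 2)) a ρ t)) :=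
    ⟨0, by rintro _ ⟨t, rfl⟩; exact minEigenvalueGram_nonneg _⟩
  -- A real supremum without an upper bound has the default value `0`; boundedness makes
  -- `upperConst` a genuine bound.
  have habove : BddAbove (Set.range fun t : Set.Icc (0 : ℝ) 1 =>
      maxEigenvalueGram (symbol (bspline (m + 2)) a ρ t)) := by
    refine ⟨(ρ * K) ^ 2, ?_⟩
    rintro _ ⟨t, rfl⟩
    refine maxEigenvalueGram_le fun i j => ?_
    rw [hsym]
    exact hK _ i j
  have hlow : 0 < lowerConst (bspline (m + 2)) a ρ := by
    have h1 : ((ρ * L) ^ 2)⁻¹ ≤ lowerConst (bspline (m + 2)) a ρ := by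
      refine le_ciInf fun t => ?_
      simp only [hsym]
      exact le_minEigenvalueGram (hdet' _) (hL _) hL0
    refine lt_of_lt_of_le ?_ h1
    have : (0 : ℝ) < ρ := by simp [hρdef]; positivity
    positivity
  have hup : 0 ≤ upperConst (bspline (m + 2)) a ρ :=
    Real.iSup_nonneg fun t => maxEigenvalueGram_nonneg _
  have hA : ∀ t v, lowerConst (bspline (m + 2)) a ρ * ∑ j, ‖v j‖ ^ 2 ≤
      ∑ i, ‖(trigMatrix s q t *ᵥ v) i‖ ^ 2 := by
    intro t v
    obtain ⟨τ, hτ, rfl⟩ := exists_coe_eq_of_unitAddCircle t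
    rw [← hsym]
    refine le_trans (mul_le_mul_of_nonneg_right (ciInf_le hbelow ⟨τ, hτ⟩) (by positivity))
      (minEigenvalueGram_mul_le _ v)
  have hB : ∀ t v, ∑ i, ‖(trigMatrix s q t *ᵥ v) i‖ ^ 2 ≤
      upperConst (bspline (m + 2)) a ρ * ∑ j, ‖v j‖ ^ 2 := by
    intro t v
    obtain ⟨τ, hτ, rfl⟩ := exists_coe_eq_of_unitAddCircle t
    rw [← hsym]
    exact (le_maxEigenvalueGram_mul _ v).trans
      (mul_le_mul_of_nonneg_right (le_ciSup habove ⟨τ, hτ⟩) (by positivity))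
  have main : ∀ {f : ℝ → ℂ} {c : ℤ → ℂ}, Summable (fun k => ‖c k‖ ^ 2) →
      (∀ x : ℝ, HasSum (fun k : ℤ => c k * (bspline (m + 2) (x - k) : ℂ)) (f x)) →
      (∀ i ∈ Finset.range ρ, Summable (fun l : ℤ =>
          ‖iteratedDeriv i f (a + (ρ : ℝ) * (l : ℝ))‖ ^ 2)) ∧
        lowerConst (bspline (m + 2)) a ρ * ∑' k, ‖c k‖ ^ 2 ≤
          ∑ i ∈ Finset.range ρ, ∑' l : ℤ, ‖iteratedDeriv i f (a + (ρ : ℝ) * (l : ℝ))‖ ^ 2 ∧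
        ∑ i ∈ Finset.range ρ, ∑' l : ℤ, ‖iteratedDeriv i f (a + (ρ : ℝ) * (l : ℝ))‖ ^ 2 ≤
          upperConst (bspline (m + 2)) a ρ * ∑' k, ‖c k‖ ^ 2 := by
    intro f c hc hf
    have h := trigConv_bounds s q hA hB (fun j => summable_divModEquiv (ρ := ρ) hc j)
    rw [sum_tsum_divModEquiv hc] at h
    have hsmp : ∀ (i : Fin ρ) (l : ℤ), iteratedDeriv (i : ℕ) f (a + (ρ : ℝ) * (l : ℝ)) =
        trigConv s q (fun j n => c ((Int.divModEquiv ρ).symm (n, j))) i l :=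
      iteratedDeriv_spline_eq_trigConv hf hm ha
    simp only [← hsmp] at h
    rw [Fin.sum_univ_eq_sum_range (fun i => ∑' l : ℤ,
      ‖iteratedDeriv i f (a + (ρ : ℝ) * (l : ℝ))‖ ^ 2) ρ] at h
    exact ⟨fun i hi => h.1 ⟨i, Finset.mem_range.1 hi⟩, h.2⟩
  have hcd : ∀ {f : ℝ → ℂ} {c : ℤ → ℂ},
      (∀ x : ℝ, HasSum (fun k : ℤ => c k * (bspline (m + 2) (x - k) : ℂ)) (f x)) →
      ContDiff ℝ (m : WithTop ℕ∞) f := fun hf => contDiff_spline hf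
  refine ⟨⟨?_, ?_⟩, hlow, ?_⟩
  · rintro f ⟨-, c, hc, hf⟩ hzero
    obtain ⟨-, h, -⟩ := main hc hf
    have h0 : ∑ i ∈ Finset.range ρ, ∑' l : ℤ,
        ‖iteratedDeriv i f (a + (ρ : ℝ) * (l : ℝ))‖ ^ 2 = 0 := by
      refine Finset.sum_eq_zero fun i hi => ?_
      have hz : ∀ l : ℤ, iteratedDeriv i f (a + (ρ : ℝ) * (l : ℝ)) = 0 :=
        fun l => hzero l ⟨i, Finset.mem_range.1 hi⟩
      simp [hz]
    rw [h0] at h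
    have h1 : ∑' k, ‖c k‖ ^ 2 = 0 := le_antisymm
      (nonpos_of_mul_nonpos_right h hlow) (tsum_nonneg fun k => sq_nonneg _)
    have h2 := (hasSum_zero_iff_of_nonneg fun k => sq_nonneg ‖c k‖).1 (h1 ▸ hc.hasSum)
    have h3 : ∀ k, c k = 0 := fun k => by simpa using congrFun h2 k
    ext x
    refine (hf x).unique ?_
    simp [h3, hasSum_zero]
  · intro d hd
    have hd' : ∀ i : Fin ρ, Summable fun l => ‖d l i‖ ^ 2 := fun i =>
      hd.comp_injective (i := fun l : ℤ => (l, i)) fun _ _ h => (Prod.ext_iff.1 h).1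
    obtain ⟨c, hc, hcd'⟩ := exists_trigConv_eq s q hdet' (d := fun i l => d l i) hd'
    -- The `ρ` solution sequences are interleaved by quotient and remainder mod `ρ`.
    set c0 : ℤ → ℂ := fun k => c (Int.divModEquiv ρ k).2 (Int.divModEquiv ρ k).1 with hc0
    have hs0 : Summable fun k => ‖c0 k‖ ^ 2 := summable_of_divModEquiv hc
    set f : ℝ → ℂ := fun x => ∑' k : ℤ, c0 k * (bspline (m + 2) (x - k) : ℂ)
    have hf : ∀ x : ℝ, HasSum (fun k : ℤ => c0 k * (bspline (m + 2) (x - k) : ℂ)) (f x) := by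
      intro x
      refine (summable_of_ne_finset_zero
        (s := Finset.Icc (⌊x⌋ - (m + 3)) (⌊x⌋ + 2)) fun k hk => ?_).hasSum
      rw [(bspline_basic (m + 1)).2.2 _
        (sub_int_notMem_Icc ⟨sub_one_lt x, lt_add_one x⟩ hk)]
      simp
    refine ⟨f, ⟨(spline_norm_bounds (m + 1) hs0 (hcd hf).continuous.measurable hf).1, c0, hs0, hf⟩,
      fun n i => ?_⟩
    refine (iteratedDeriv_spline_eq_trigConv hf hm ha (ρ := ρ) i n).trans ?_
    have : (fun (j : Fin ρ) n => c0 ((Int.divModEquiv ρ).symm (n, j))) = c := by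
      ext j n
      simp only [hc0, Equiv.apply_symm_apply]
    rw [this]
    exact congrFun (congrFun hcd' i) n
  · rintro f ⟨-, c, hc, hf⟩
    obtain ⟨h1, h2, h3⟩ := main hc hf
    obtain ⟨-, h4, h5⟩ := spline_norm_bounds (m + 1) hc (hcd hf).continuous.measurable hf
    refine ⟨(hcd hf).of_le (by exact_mod_cast Nat.le_of_succ_le_succ hm), h1,
      (mul_le_mul_of_nonneg_left h5 hlow.le).trans h2, h3.trans ?_⟩
    -- The Favard factor is the reciprocal of the lower Riesz bound, so `h4` gives `∑ |c_k|² ≤`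
    -- factor `· ‖f‖²`.
    rw [favard_factor (m + 1), mul_assoc]
    refine mul_le_mul_of_nonneg_left ?_ hup
    rw [le_inv_mul_iff₀ (cscPoly_eval_zero_pos (m + 1))]
    exact h4

theorem theorem3p7 (m ρ : ℕ) (hρ : 1 ≤ ρ) (hm : ρ < m) (a : ℝ) (ha : a = 0 ∨ a = 1 / 2)
    (hdet : ∀ t ∈ Set.Icc (0 : ℝ) 1,
      (SplineSampling.symbol (SplineSampling.bspline m) a ρ t).det ≠ 0) :
    SplineSampling.IsCompleteInterpolationSet (SplineSampling.bspline m) (ρ - 1)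
        (fun l : ℤ => a + (ρ : ℝ) * (l : ℝ)) ∧
      0 < SplineSampling.lowerConst (SplineSampling.bspline m) a ρ ∧
      ∀ f ∈ SplineSampling.shiftInvariantSpace (SplineSampling.bspline m),
        ContDiff ℝ ((ρ - 1 : ℕ) : WithTop ℕ∞) f ∧
        (∀ i ∈ Finset.range ρ,
          Summable (fun l : ℤ => ‖iteratedDeriv i f (a + (ρ : ℝ) * (l : ℝ))‖ ^ 2)) ∧
        SplineSampling.lowerConst (SplineSampling.bspline m) a ρ * (∫ x : ℝ, ‖f x‖ ^ 2) ≤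
          ∑ i ∈ Finset.range ρ, ∑' l : ℤ, ‖iteratedDeriv i f (a + (ρ : ℝ) * (l : ℝ))‖ ^ 2 ∧
        ∑ i ∈ Finset.range ρ, ∑' l : ℤ, ‖iteratedDeriv i f (a + (ρ : ℝ) * (l : ℝ))‖ ^ 2 ≤
          SplineSampling.upperConst (SplineSampling.bspline m) a ρ *
            (Real.pi ^ (2 * m - 1) /
              (2 ^ (2 * m - 1) * SplineSampling.favardConst (2 * m - 1))) *
            (∫ x : ℝ, ‖f x‖ ^ 2) := by
  obtain ⟨r, rfl⟩ : ∃ r, ρ = r + 1 := ⟨ρ - 1, by omega⟩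
  obtain ⟨n, rfl⟩ : ∃ n, m = n + 2 := ⟨m - 2, by omega⟩
  exact spline_completeInterpolation_and_bounds n r (by omega) a ha hdet
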